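/- Let $N\ge 0$ and $\hbar>0$. Write $z=(x,p)\in\mathbb R^{N}\times\mathbb R^{N}$ and $z\wedge z'=p\cdot x'-p'\cdot x$, and let $\mathbf H_N=\mathbb R^{2N}\times\mathbb R$ be the Heisenberg group with the law $(z,t)(z',t')=(z+z',\,t+t'+\tfrac12 z\wedge z')$. For $(z_0,t_0)\in\mathbf H_N$, $z_0=(x_0,p_0)$, define the unitary operators $$\widehat T_{\rm Sch}(z_0,t_0)\psi(x)=e^{\frac i\hbar(t_0+p_0\cdot x-\frac12p_0\cdot x_0)}\psi(x-x_0)\quad\text{on }L^2(\mathbb R^N),$$ $$\widehat T_{\rm ph}(z_0,t_0)\Psi(z)=e^{\frac i\hbar t_0}\,e^{-\frac{i}{2\hbar}z\wedge z_0}\,\Psi(z-z_0)\quad\text{on }L^2(\mathbb R^{2N}).$$ Both are representations of $\mathbf H_N$. Write $\widehat T(z_0)=\widehat T(z_0,0)$. For $\phi\in\mathcal S(\mathbb R^N)$ with $\|\phi\|_{L^2}=1$ let $$U_\phi\psi(z)=(2\pi\hbar)^{-N/2}e^{\frac{i}{2\hbar}p\cdot x}\int e^{-\frac i\hbar p\cdot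 x'}\psi(x')\,\phi(x-x')\,dx' .$$ For a symbol $A$ on $\mathbb R^{2N}$ let $\mathcal F_\sigma A(z)=(2\pi\hbar)^{-N}\int e^{-\frac i\hbar z\wedge z'}A(z')\,dz'$ (extended by duality to tempered distributions) and $$\widehat A_{\rm Sch}=(2\pi\hbar)^{-N}\!\int \mathcal F_\sigma A(z_0)\,\widehat T_{\rm Sch}(z_0)\,dz_0,\qquad \widehat A_{\rm ph}=(2\pi\hbar)^{-N}\!\int \mathcal F_\sigma A(z_0)\,\widehat T_{\rm ph}(z_0)\,dz_0 .$$ **Theorem.** For every such $\phi$ the transform $U_\phi$ is a linear isometry $L^2(\mathbb R^N)\to L^2(\mathbb R^{2N})$ with closed range $\mathcal H_\phi$, and: (i) $\widehat T_{\rm ph}(z_0,t_0)\,U_\phi=U_\phi\,\widehat T_{\rm Sch}(z_0,t_0)$ for all $(z_0,t_0)\in\mathbf H_N$. The space $\mathcal H_\phi$ is invariant under $\widehat T_{\rm ph}$, and the restriction of $\widehat T_{\rm ph}$ to $\mathcal H_\phi$ is unitarily equivalent to $\widehat T_{\rm Sch}$ and is an irreducible (strongly continuous) unitary representation of $\mathbf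 H_N$. (ii) $\widehat A_{\rm ph}U_\phi=U_\phi\widehat A_{\rm Sch}$, in each of the following senses. (a) For every tempered distribution $A\in\mathcal S'(\mathbb R^{2N})$ and every $\psi\in\mathcal S(\mathbb R^N)$ one has $\widehat A_{\rm ph}(U_\phi\psi)(z)=U_\phi(\widehat A_{\rm Sch}\psi)(z)$ for every $z\in\mathbb R^{2N}$. Here $U_\phi\psi\in\mathcal S(\mathbb R^{2N})$; for $\Psi\in\mathcal S(\mathbb R^{2N})$ the number $\widehat A_{\rm ph}\Psi(z)$ is $(2\pi\hbar)^{-N}$ times the value of $\mathcal F_\sigma A$ on the Schwartz function $z_0\mapsto(\widehat T_{\rm ph}(z_0)\Psi)(z)$; $\widehat A_{\rm Sch}\psi\in\mathcal S'(\mathbb R^N)$ is given by $\langle\widehat A_{\rm Sch}\psi,\chi\rangle=(2\pi\hbar)^{-N}\langle\mathcal F_\sigma A,\ z_0\mapsto\int(\widehat T_{\rm Sch}(z_0)\psi)\chi\,dx\rangle$; and $U_\phi$ acts on $\mathcal S'(\mathbb R^N)$ by evaluating the distribution on the integral kernel of $U_\phi$. (b) If, for some $A\in\mathcal S'(\mathbb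 R^{2N})$, the operators of (a) extend from Schwartz functions to bounded operators on $L^2(\mathbb R^N)$ and on $L^2(\mathbb R^{2N})$, then the extensions satisfy $\widehat A_{\rm ph}U_\phi=U_\phi\widehat A_{\rm Sch}$ on $L^2(\mathbb R^N)$. (c) If $A$ and $\mathcal F_\sigma A$ are integrable functions, then $\widehat A_{\rm ph}U_\phi\psi=U_\phi\widehat A_{\rm Sch}\psi$ for all $\psi\in L^2(\mathbb R^N)$, the integrals defining both operators applied to a vector being Bochner integrals in $L^2$. -/

import Mathlib

open MeasureTheory MeasureTheory.Measure SchwartzMap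
open scoped FourierTransform ContDiff


namespace PhaseSpaceWeyl

noncomputable section

/-! ### Auxiliary facts on Schwartz functions -/

section SchwartzTools

theorem hasTemperateGrowth_cexp_mul_I :
    Function.HasTemperateGrowth (fun t : ℝ => Complex.exp (t * Complex.I)) := by
  have hd : ∀ n : ℕ, iteratedDeriv n (fun t : ℝ => Complex.exp (t * Complex.I))
      = fun t : ℝ => Complex.I ^ n * Complex.exp (t * Complex.I) := by
    intro n
    induction n with
    | zero => simp
    | succ n ih =>
      rw [iteratedDeriv_succ, ih]
      ext t
      have h := ((Complex.ofRealCLM.hasDerivAt (x := t)).mul_const Complex.I).cexp.const_mul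
        (Complex.I ^ n)
      simp only [Complex.ofRealCLM_apply, Complex.ofReal_one, one_mul] at h
      rw [h.deriv]
      ring
  refine ⟨?_, fun n => ⟨0, 1, fun t => ?_⟩⟩
  · have h : ContDiff ℝ ∞ (fun t : ℝ => (t : ℂ)) := Complex.ofRealCLM.contDiff
    exact (h.mul contDiff_const).cexp
  · rw [norm_iteratedFDeriv_eq_norm_iteratedDeriv, hd n]
    simp [Complex.norm_exp_ofReal_mul_I]

variable {D : Type} [NormedAddCommGroup D] [NormedSpace ℝ D]

/-- For a Schwartz function `f`, the function `w ↦ e^{i (c + ℓ w)} f (a - w)` is Schwartz. -/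
theorem exists_schwartz_modulated_reflection (k : ℂ) (c : ℝ) (l : D →L[ℝ] ℝ) (a : D)
    (f : 𝓢(D, ℂ)) :
    ∃ g : 𝓢(D, ℂ), ∀ w, g w = k * Complex.exp (((c + l w : ℝ) : ℂ) * Complex.I) * f (a - w) := by
  have hl : Function.HasTemperateGrowth
      (fun w : D => k * Complex.exp (((c + l w : ℝ) : ℂ) * Complex.I)) :=
    (Function.HasTemperateGrowth.const k).mul (hasTemperateGrowth_cexp_mul_I.comp
      (f := fun w : D => c + l w)
      ((Function.HasTemperateGrowth.const c).add l.hasTemperateGrowth))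
  refine ⟨smulLeftCLM ℂ (fun w : D => k * Complex.exp (((c + l w : ℝ) : ℂ) * Complex.I))
    (compSubConstCLM ℂ a (compCLMOfContinuousLinearEquiv ℂ (ContinuousLinearEquiv.neg ℝ) f)), ?_⟩
  intro w
  rw [smulLeftCLM_apply_apply hl]
  simp

/-- The tensor product `(x, y) ↦ f x * g y` with a fixed Schwartz function `f`, as a continuous
linear map in the Schwartz function `g`. -/
theorem exists_tensor {E : Type} [NormedAddCommGroup E] [NormedSpace ℝ E]
    (f : 𝓢(D, ℂ)) :
    ∃ L : 𝓢(E, ℂ) →L[ℂ] 𝓢(D × E, ℂ), ∀ g z, L g z = f z.1 * g z.2 := by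
  refine ⟨mkCLM (fun g z => f z.1 * g z.2) (fun g h z => by simp [mul_add])
    (fun a g z => by simp [mul_left_comm])
    (fun g => ((f.smooth ⊤).comp contDiff_fst).mul ((g.smooth ⊤).comp contDiff_snd)) ?_,
    fun g z => rfl⟩
  rintro ⟨k, n⟩
  dsimp only
  have key : ∀ i ≤ n, ∃ C : ℝ, 0 ≤ C ∧ ∀ (g : 𝓢(E, ℂ)) (z : D × E),
      ‖z‖ ^ k * (‖iteratedFDeriv ℝ i (fun z : D × E => f z.1) z‖ *
        ‖iteratedFDeriv ℝ (n - i) (fun z : D × E => g z.2) z‖) ≤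
      C * ((Finset.Iic (k, n)).sup (schwartzSeminormFamily ℂ E ℂ)) g := by
    intro i hi
    refine ⟨SchwartzMap.seminorm ℝ k i f + SchwartzMap.seminorm ℝ 0 i f, by positivity,
      fun g z => ?_⟩
    have h1 : ‖iteratedFDeriv ℝ i (fun z : D × E => f z.1) z‖ ≤ ‖iteratedFDeriv ℝ i f z.1‖ := by
      have := (ContinuousLinearMap.fst ℝ D E).iteratedFDeriv_comp_right (f.smooth ⊤) z
        (i := i) (mod_cast le_top)
      change ‖iteratedFDeriv ℝ i (f ∘ (ContinuousLinearMap.fst ℝ D E)) z‖ ≤ _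
      rw [this]
      refine (ContinuousMultilinearMap.norm_compContinuousLinearMap_le _ _).trans ?_
      refine mul_le_of_le_one_right (norm_nonneg _) ?_
      exact Finset.prod_le_one (fun _ _ => norm_nonneg _)
        (fun _ _ => ContinuousLinearMap.norm_fst_le ℝ D E)
    have h2 : ‖iteratedFDeriv ℝ (n - i) (fun z : D × E => g z.2) z‖ ≤
        ‖iteratedFDeriv ℝ (n - i) g z.2‖ := by
      have := (ContinuousLinearMap.snd ℝ D E).iteratedFDeriv_comp_right (g.smooth ⊤) z
        (i := n - i) (by generalize n - i = j; exact_mod_cast le_top)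
      change ‖iteratedFDeriv ℝ (n - i) (g ∘ (ContinuousLinearMap.snd ℝ D E)) z‖ ≤ _
      rw [this]
      refine (ContinuousMultilinearMap.norm_compContinuousLinearMap_le _ _).trans ?_
      refine mul_le_of_le_one_right (norm_nonneg _) ?_
      exact Finset.prod_le_one (fun _ _ => norm_nonneg _)
        (fun _ _ => ContinuousLinearMap.norm_snd_le ℝ D E)
    have hz : ‖z‖ ^ k ≤ ‖z.1‖ ^ k + ‖z.2‖ ^ k := by
      rcases le_total ‖z.1‖ ‖z.2‖ with h | h
      · rw [Prod.norm_def, max_eq_right h]; exact le_add_of_nonneg_left (by positivity)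
      · rw [Prod.norm_def, max_eq_left h]; exact le_add_of_nonneg_right (by positivity)
    set S := ((Finset.Iic (k, n)).sup (schwartzSeminormFamily ℂ E ℂ)) g with hS
    have hg : ∀ k' ≤ k, ‖z.2‖ ^ k' * ‖iteratedFDeriv ℝ (n - i) g z.2‖ ≤ S := by
      intro k' hk'
      refine (SchwartzMap.le_seminorm ℂ k' (n - i) g z.2).trans ?_
      exact Seminorm.le_def.1 (Finset.le_sup (f := schwartzSeminormFamily ℂ E ℂ)
        (Finset.mem_Iic.2 (show ((k', n - i) : ℕ × ℕ) ≤ (k, n) from ⟨hk', Nat.sub_le _ _⟩))) g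
    have hg0 := hg 0 (Nat.zero_le _)
    have hgk := hg k le_rfl
    rw [pow_zero, one_mul] at hg0
    have hf0 := SchwartzMap.le_seminorm ℝ 0 i f z.1
    have hfk := SchwartzMap.le_seminorm ℝ k i f z.1
    rw [pow_zero, one_mul] at hf0
    calc _ ≤ (‖z.1‖ ^ k + ‖z.2‖ ^ k) * (‖iteratedFDeriv ℝ i f z.1‖ *
            ‖iteratedFDeriv ℝ (n - i) g z.2‖) := by gcongr
      _ = (‖z.1‖ ^ k * ‖iteratedFDeriv ℝ i f z.1‖) * ‖iteratedFDeriv ℝ (n - i) g z.2‖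
          + ‖iteratedFDeriv ℝ i f z.1‖ * (‖z.2‖ ^ k * ‖iteratedFDeriv ℝ (n - i) g z.2‖) := by ring
      _ ≤ SchwartzMap.seminorm ℝ k i f * S + SchwartzMap.seminorm ℝ 0 i f * S := by gcongr
      _ = _ := by ring
  choose! C hC0 hC using key
  refine ⟨Finset.Iic (k, n), ∑ i ∈ Finset.range (n + 1), (n.choose i) * C i,
    Finset.sum_nonneg fun i hi => mul_nonneg (by positivity)
      (hC0 i (Nat.lt_succ_iff.1 (Finset.mem_range.1 hi))), fun g z => ?_⟩
  have hm := norm_iteratedFDeriv_mul_le (𝕜 := ℝ) (N := ∞)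
    ((f.smooth ⊤).comp (contDiff_fst (E := D) (F := E)))
    ((g.smooth ⊤).comp (contDiff_snd (E := D) (F := E))) z (n := n) (mod_cast le_top)
  calc _ ≤ ‖z‖ ^ k * ∑ i ∈ Finset.range (n + 1), (n.choose i : ℝ) *
          ‖iteratedFDeriv ℝ i (fun z : D × E => f z.1) z‖ *
          ‖iteratedFDeriv ℝ (n - i) (fun z : D × E => g z.2) z‖ := by gcongr; exact hm
    _ = ∑ i ∈ Finset.range (n + 1), (n.choose i : ℝ) * (‖z‖ ^ k *
          (‖iteratedFDeriv ℝ i (fun z : D × E => f z.1) z‖ *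
          ‖iteratedFDeriv ℝ (n - i) (fun z : D × E => g z.2) z‖)) := by
        rw [Finset.mul_sum]; refine Finset.sum_congr rfl fun i _ => ?_; ring
    _ ≤ ∑ i ∈ Finset.range (n + 1), (n.choose i : ℝ) *
          (C i * ((Finset.Iic (k, n)).sup (schwartzSeminormFamily ℂ E ℂ)) g) := by
        refine Finset.sum_le_sum fun i hi => ?_
        refine mul_le_mul_of_nonneg_left ?_ (by positivity)
        exact hC i (Nat.lt_succ_iff.1 (Finset.mem_range.1 hi)) g z
    _ = _ := by rw [Finset.sum_mul]; refine Finset.sum_congr rfl fun i _ => ?_; ring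

variable {E : Type} [NormedAddCommGroup E] [InnerProductSpace ℝ E] [FiniteDimensional ℝ E]
  [MeasurableSpace E] [BorelSpace E]
  {V : Type} [NormedAddCommGroup V] [NormedSpace ℝ V] [NormedSpace ℂ V] [IsScalarTower ℝ ℂ V]

/-- The integrand `e^{-i c p·y} F (x, y)` of the partial Fourier transform. -/
def partialFourierIntegrand (c : ℝ) (F : E × E → V) (z : E × E) (y : E) : V :=
  Complex.exp (((-(c * inner ℝ z.2 y) : ℝ) : ℂ) * Complex.I) • F (z.1, y)

theorem norm_partialFourierIntegrand (c : ℝ) (F : E × E → V) (z : E × E) (y : E) :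
    ‖partialFourierIntegrand c F z y‖ = ‖F (z.1, y)‖ := by
  rw [partialFourierIntegrand, norm_smul, Complex.norm_exp_ofReal_mul_I, one_mul]

/-- The partial Fourier transform `(x, p) ↦ ∫ e^{-i c p·y} F (x, y) dy`. -/
def partialFourier (c : ℝ) (F : E × E → V) (z : E × E) : V :=
  ∫ y, partialFourierIntegrand c F z y

theorem normedSpace_eq_complexToReal (V : Type) [NormedAddCommGroup V] [i : NormedSpace ℝ V]
    [NormedSpace ℂ V] [IsScalarTower ℝ ℂ V] : i = NormedSpace.complexToReal := by
  have h : i.toModule = (NormedSpace.complexToReal (E := V)).toModule :=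
    Module.ext' _ _ fun r v => by
      change r • v = (r : ℂ) • v
      rw [← Complex.coe_algebraMap, algebraMap_smul]
  cases i
  simp only at h
  subst h
  rfl

theorem partialFourier_eq (c : ℝ) (F : E × E → V) (z : E × E) :
    partialFourier c F z = 𝓕 (fun y => F (z.1, y)) ((c / (2 * Real.pi)) • z.2) := by
  obtain rfl := normedSpace_eq_complexToReal V
  rw [Real.fourier_eq']
  refine integral_congr_ae (Filter.Eventually.of_forall fun y => ?_)
  simp only [partialFourierIntegrand]
  congr 3
  rw [inner_smul_right, real_inner_comm]
  have := Real.pi_ne_zero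
  field_simp

theorem schwartz_slice_bound (k : ℕ) :
    ∃ q : Seminorm ℂ 𝓢(E × E, V), Continuous q ∧ ∀ (F : 𝓢(E × E, V)) (x y : E),
      ‖x‖ ^ k * ‖F (x, y)‖ ≤
        2 ^ (k + (volume : Measure E).integrablePower) * q F * (1 + ‖y‖) ^ (-((volume : Measure E).integrablePower : ℝ)) := by
  set r := (volume : Measure E).integrablePower
  refine ⟨(Finset.Iic (k + r, 0)).sup (schwartzSeminormFamily ℂ (E × E) V), ?_, ?_⟩
  · exact Seminorm.continuous_finsetSup fun i _ =>
      (schwartz_withSeminorms ℂ (E × E) V).continuous_seminorm i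
  · intro F x y
    have h := one_add_le_sup_seminorm_apply (𝕜 := ℂ) (m := (k + r, 0)) (k := k + r) (n := 0)
      le_rfl le_rfl F (x, y)
    rw [norm_iteratedFDeriv_zero] at h
    rw [Real.rpow_neg (by positivity), ← div_eq_mul_inv, le_div_iff₀ (by positivity),
      Real.rpow_natCast]
    calc _ = (‖x‖ ^ k * (1 + ‖y‖) ^ r) * ‖F (x, y)‖ := by ring
      _ ≤ ((1 + ‖(x, y)‖) ^ k * (1 + ‖(x, y)‖) ^ r) * ‖F (x, y)‖ := by
        have h1 : ‖x‖ ≤ 1 + ‖(x, y)‖ := (norm_fst_le (x, y)).trans (by simp)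
        have h2 : ‖y‖ ≤ ‖(x, y)‖ := norm_snd_le (x, y)
        gcongr
      _ ≤ _ := by rw [← pow_add]; exact h

theorem integrable_slice (F : 𝓢(E × E, V)) (x : E) : Integrable (fun y => F (x, y)) := by
  obtain ⟨q, -, hq⟩ := schwartz_slice_bound (E := E) (V := V) 0
  refine Integrable.mono' ((integrable_pow_neg_integrablePower
    (volume : Measure E)).const_mul
      (2 ^ (0 + (volume : Measure E).integrablePower) * q F)) ?_ (Filter.Eventually.of_forall fun y => ?_)
  · exact (F.continuous.comp (by fun_prop : Continuous fun y : E => (x, y))).aestronglyMeasurable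
  · simpa using hq F x y

theorem aestronglyMeasurable_slice (c : ℝ) (F : 𝓢(E × E, V)) (z : E × E) :
    AEStronglyMeasurable (partialFourierIntegrand c F z) := by
  have h : Continuous (fun y : E =>
      Complex.exp (((-(c * inner ℝ z.2 y) : ℝ) : ℂ) * Complex.I)) := by fun_prop
  exact (h.smul (F.continuous.comp
      (by fun_prop : Continuous fun y : E => (z.1, y)))).aestronglyMeasurable

theorem partialFourier_bound_fst (c : ℝ) (k : ℕ) :
    ∃ (q : Seminorm ℂ 𝓢(E × E, V)) (C : ℝ), Continuous q ∧ 0 ≤ C ∧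
      ∀ (F : 𝓢(E × E, V)) (z : E × E),
      ‖z.1‖ ^ k * ‖partialFourier c F z‖ ≤ C * q F := by
  obtain ⟨q, hqc, hq⟩ := schwartz_slice_bound (E := E) (V := V) k
  set J := ∫ y : E, (1 + ‖y‖) ^ (-((volume : Measure E).integrablePower : ℝ))
  have hJ : 0 ≤ J := integral_nonneg fun y => by positivity
  set K : ℝ := 2 ^ (k + (volume : Measure E).integrablePower)
  refine ⟨q, K * J, hqc, by positivity, fun F z => ?_⟩
  have hint := integrable_pow_neg_integrablePower (volume : Measure E)
  calc _ ≤ ‖z.1‖ ^ k * ∫ y, ‖F (z.1, y)‖ := by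
        gcongr
        refine (norm_integral_le_integral_norm _).trans_eq ?_
        simp only [norm_partialFourierIntegrand]
    _ = ∫ y, ‖z.1‖ ^ k * ‖F (z.1, y)‖ := (integral_const_mul _ _).symm
    _ ≤ ∫ y, K * q F * (1 + ‖y‖) ^ (-((volume : Measure E).integrablePower : ℝ)) :=
        integral_mono ((integrable_slice F z.1).norm.const_mul _) (hint.const_mul _)
          fun y => hq F z.1 y
    _ = K * J * q F := by rw [integral_const_mul]; ring

theorem partialFourier_bound_snd {c : ℝ} (hc : c ≠ 0) (k : ℕ) :
    ∀ (V : Type) [NormedAddCommGroup V] [NormedSpace ℝ V] [NormedSpace ℂ V] [IsScalarTower ℝ ℂ V],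
    ∃ (q : Seminorm ℂ 𝓢(E × E, V)) (C : ℝ), Continuous q ∧ 0 ≤ C ∧
      ∀ (F : 𝓢(E × E, V)) (z : E × E),
      ‖z.2‖ ^ k * ‖partialFourier c F z‖ ≤ C * q F := by
  induction k with
  | zero =>
    intro V _ iR _ _
    obtain ⟨q, C, hqc, hC, hq⟩ := partialFourier_bound_fst (E := E) (V := V) c 0
    exact ⟨q, C, hqc, hC, fun F z => by simpa using hq F z⟩
  | succ k ih =>
    intro V _ iR _ _
    obtain rfl := normedSpace_eq_complexToReal V
    obtain ⟨q, C, hqc, hC, hq⟩ := ih (E →L[ℝ] V)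
    let P : (E × E →L[ℝ] V) →L[ℂ] (E →L[ℝ] V) :=
      { toFun := fun T => T.comp (ContinuousLinearMap.inr ℝ E E)
        map_add' := fun _ _ => by ext; simp
        map_smul' := fun _ _ => by ext; simp
        cont := by fun_prop }
    let L : 𝓢(E × E, V) →L[ℂ] 𝓢(E × E, E →L[ℝ] V) :=
      (postcompCLM P).comp (fderivCLM ℂ (E × E) V)
    refine ⟨q.comp L.toLinearMap, |c|⁻¹ * C, hqc.comp L.continuous, by positivity,
      fun F z => ?_⟩
    have hder : ∀ y, HasFDerivAt (fun y => F (z.1, y)) (L F (z.1, y)) y := fun y =>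
      (F.differentiable (z.1, y)).hasFDerivAt.comp y (hasFDerivAt_prodMk_right z.1 y)
    have hfd : fderiv ℝ (fun y => F (z.1, y)) = fun y => L F (z.1, y) :=
      funext fun y => (hder y).fderiv
    have h := Real.fourier_fderiv (integrable_slice F z.1) (fun y => (hder y).differentiableAt)
      (by rw [hfd]; exact integrable_slice (L F) z.1)
    rw [hfd] at h
    have h' := congrFun h ((c / (2 * Real.pi)) • z.2)
    rw [← partialFourier_eq c (L F) z] at h'
    have hn : ‖partialFourier c (L F) z‖ = |c| * (‖z.2‖ * ‖partialFourier c F z‖) := by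
      rw [h', partialFourier_eq c F z]
      rw [VectorFourier.norm_fourierSMulRight, _root_.neg_apply, norm_neg,
        innerSL_apply_norm, norm_smul, Real.norm_eq_abs, abs_div,
        abs_of_pos (by positivity : 0 < 2 * Real.pi)]
      field_simp
    have hc' : 0 < |c| := abs_pos.2 hc
    have := hq (L F) z
    rw [hn] at this
    change _ ≤ |c|⁻¹ * C * q (L F)
    rw [mul_assoc, inv_mul_eq_div, le_div_iff₀ hc', pow_succ]
    calc _ = _ := by ring
      _ ≤ _ := this

theorem partialFourier_bound {c : ℝ} (hc : c ≠ 0) (k : ℕ) :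
    ∃ (q : Seminorm ℂ 𝓢(E × E, V)) (C : ℝ), Continuous q ∧ 0 ≤ C ∧
      ∀ (F : 𝓢(E × E, V)) (z : E × E),
      ‖z‖ ^ k * ‖partialFourier c F z‖ ≤ C * q F := by
  obtain ⟨q₁, C₁, hc₁, hC₁, h₁⟩ := partialFourier_bound_fst (E := E) (V := V) c k
  obtain ⟨q₂, C₂, hc₂, hC₂, h₂⟩ := partialFourier_bound_snd (E := E) hc k V
  refine ⟨q₁ + q₂, C₁ + C₂, hc₁.add hc₂, by positivity, fun F z => ?_⟩
  have h₁ := h₁ F z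
  have h₂ := h₂ F z
  have p₁ : 0 ≤ q₁ F := apply_nonneg _ _
  have p₂ : 0 ≤ q₂ F := apply_nonneg _ _
  change _ ≤ (C₁ + C₂) * (q₁ F + q₂ F)
  have m₁ := mul_nonneg hC₁ p₁
  have m₂ := mul_nonneg hC₁ p₂
  have m₃ := mul_nonneg hC₂ p₁
  have m₄ := mul_nonneg hC₂ p₂
  rcases le_total ‖z.1‖ ‖z.2‖ with h | h
  · rw [Prod.norm_def, max_eq_right h]; nlinarith
  · rw [Prod.norm_def, max_eq_left h]; nlinarith

/-- Differentiating `partialFourier c F` amounts to replacing `F` by another Schwartz function. -/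
theorem exists_fderiv_partialFourier (c : ℝ) :
    ∃ L : 𝓢(E × E, V) →L[ℂ] 𝓢(E × E, E × E →L[ℝ] V), ∀ (F : 𝓢(E × E, V)) (z : E × E),
      HasFDerivAt (partialFourier c F) (partialFourier c (L F) z) z := by
  let B : E × E →L[ℝ] (E × E →L[ℝ] ℝ) :=
    ((ContinuousLinearMap.compL ℝ (E × E) E ℝ).flip (ContinuousLinearMap.snd ℝ E E)).comp
      ((innerSL ℝ).comp (ContinuousLinearMap.snd ℝ E E))
  have hB : ∀ w w', B w w' = inner ℝ w.2 w'.2 := fun w w' => by simp [B]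
  obtain ⟨L, hL⟩ : ∃ L : 𝓢(E × E, V) →L[ℂ] 𝓢(E × E, E × E →L[ℝ] V), ∀ F w w', L F w w' =
      fderiv ℝ F w (w'.1, 0) + (-(c : ℂ) * Complex.I) • inner ℝ w.2 w'.2 • F w := by
    let P : (E × E →L[ℝ] V) →L[ℂ] (E × E →L[ℝ] V) :=
      { toFun := fun T => T.comp ((ContinuousLinearMap.inl ℝ E E).comp
          (ContinuousLinearMap.fst ℝ E E))
        map_add' := fun _ _ => by ext <;> simp
        map_smul' := fun _ _ => by ext <;> simp
        cont := by fun_prop }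
    refine ⟨(postcompCLM P).comp (fderivCLM ℂ (E × E) V) +
      (-(c : ℂ) * Complex.I) • smulRightCLM ℂ V B, fun F w w' => ?_⟩
    simp [P, B]
  refine ⟨L, fun F z => ?_⟩
  obtain ⟨q, -, hq⟩ := schwartz_slice_bound (E := E) (V := E × E →L[ℝ] V) 0
  refine hasFDerivAt_integral_of_dominated_of_fderiv_le (𝕜 := ℝ)
    (F := partialFourierIntegrand c F) (F' := partialFourierIntegrand c (L F))
    (bound := fun y => 2 ^ (0 + (volume : Measure E).integrablePower) * q (L F) * (1 + ‖y‖) ^ (-((volume : Measure E).integrablePower : ℝ)))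
    (s := Set.univ) Filter.univ_mem ?_ ?_ ?_ ?_ ?_ ?_
  · exact Filter.Eventually.of_forall fun z => aestronglyMeasurable_slice c F z
  · refine (integrable_slice F z.1).mono (aestronglyMeasurable_slice c F z)
      (Filter.Eventually.of_forall fun y => ?_)
    rw [norm_partialFourierIntegrand]
  · exact aestronglyMeasurable_slice c (L F) z
  · refine Filter.Eventually.of_forall fun y z _ => ?_
    rw [norm_partialFourierIntegrand]
    simpa using hq (L F) z.1 y
  · exact (integrable_pow_neg_integrablePower (volume : Measure E)).const_mul _
  · refine Filter.Eventually.of_forall fun y z _ => ?_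
    have h1 : HasFDerivAt (fun z : E × E => F (z.1, y))
        ((fderiv ℝ F (z.1, y)).comp ((ContinuousLinearMap.inl ℝ E E).comp
          (ContinuousLinearMap.fst ℝ E E))) z := by
      have ha : HasFDerivAt (fun z : E × E => (z.1, y))
          ((ContinuousLinearMap.inl ℝ E E).comp (ContinuousLinearMap.fst ℝ E E)) z :=
        HasFDerivAt.comp (g := fun x : E => (x, y)) z (hasFDerivAt_prodMk_left z.1 y)
          hasFDerivAt_fst
      exact (F.differentiable (z.1, y)).hasFDerivAt.comp z ha
    have h2 : HasFDerivAt (fun z : E × E => -(c * inner ℝ z.2 y)) (-(c • B (z.1, y))) z := by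
      have h : HasFDerivAt (fun z : E × E => inner ℝ z.2 y) (B (z.1, y)) z := by
        have : (fun z : E × E => inner ℝ z.2 y) = B (z.1, y) := by
          ext w; simp [hB, real_inner_comm]
        rw [this]
        exact (B (z.1, y)).hasFDerivAt
      exact (h.const_mul c).neg
    have h3 := ((Complex.ofRealCLM.hasFDerivAt.comp z h2).mul_const Complex.I).cexp
    have h4 := h3.smul h1
    rw [partialFourierIntegrand]
    refine h4.congr_fderiv ?_
    ext w
    · simp [hL, hB]
    · simp only [ContinuousLinearMap.comp_apply, ContinuousLinearMap.inr_apply]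
      simp [hL, hB]
      rw [← algebraMap_smul ℂ (inner ℝ y w) (F (z.1, y)), smul_smul, smul_smul]
      congr 1
      simp only [Complex.coe_algebraMap]
      ring

theorem partialFourier_smooth_bound {c : ℝ} (hc : c ≠ 0) (n : ℕ) :
    ∀ (V : Type) [NormedAddCommGroup V] [NormedSpace ℝ V] [NormedSpace ℂ V] [IsScalarTower ℝ ℂ V]
      (k : ℕ),
    (∀ F : 𝓢(E × E, V), ContDiff ℝ n (partialFourier c F)) ∧
    ∃ (q : Seminorm ℂ 𝓢(E × E, V)) (C : ℝ), Continuous q ∧ 0 ≤ C ∧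
      ∀ (F : 𝓢(E × E, V)) (z : E × E),
      ‖z‖ ^ k * ‖iteratedFDeriv ℝ n (partialFourier c F) z‖ ≤ C * q F := by
  induction n with
  | zero =>
    intro V _ _ _ _ k
    obtain ⟨L, hL⟩ := exists_fderiv_partialFourier (E := E) (V := V) c
    refine ⟨fun F => ?_, ?_⟩
    · rw [Nat.cast_zero, contDiff_zero]
      exact continuous_iff_continuousAt.2 fun z => (hL F z).continuousAt
    · simpa only [norm_iteratedFDeriv_zero] using partialFourier_bound (E := E) (V := V) hc k
  | succ n ih =>
    intro V _ _ _ _ k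
    obtain ⟨L, hL⟩ := exists_fderiv_partialFourier (E := E) (V := V) c
    obtain ⟨hsm, q, C, hqc, hC, hq⟩ := ih (E × E →L[ℝ] V) k
    have hfd : ∀ F : 𝓢(E × E, V), fderiv ℝ (partialFourier c F) = partialFourier c (L F) :=
      fun F => funext fun z => (hL F z).fderiv
    refine ⟨fun F => ?_, q.comp L.toLinearMap, C, ?_, hC, fun F z => ?_⟩
    · rw [Nat.cast_succ, contDiff_succ_iff_fderiv]
      refine ⟨fun z => (hL F z).differentiableAt, by simp, ?_⟩
      rw [hfd]
      exact hsm (L F)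
    · exact (show Continuous fun F => q (L F) from hqc.comp L.continuous)
    · rw [← norm_iteratedFDeriv_fderiv, hfd]
      exact hq (L F) z

/-- The partial Fourier transform is a continuous linear operator on the Schwartz space. -/
theorem exists_partialFourierCLM {c : ℝ} (hc : c ≠ 0) :
    ∃ L : 𝓢(E × E, ℂ) →L[ℂ] 𝓢(E × E, ℂ), ∀ F z, L F z = ∫ y,
      Complex.exp (((-(c * inner ℝ z.2 y) : ℝ) : ℂ) * Complex.I) * F (z.1, y) := by
  refine ⟨mkCLM (fun F => partialFourier c F) (fun F G z => ?_) (fun a F z => ?_) (fun F => ?_) ?_,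
    fun F z => rfl⟩
  · have h : ∀ F : 𝓢(E × E, ℂ), Integrable (partialFourierIntegrand c F z) := fun F =>
      (integrable_slice F z.1).mono (aestronglyMeasurable_slice c F z)
        (Filter.Eventually.of_forall fun y => by rw [norm_partialFourierIntegrand])
    simp only [partialFourier]
    rw [← integral_add (h F) (h G)]
    simp [partialFourierIntegrand, mul_add]
  · simp only [partialFourier]
    rw [RingHom.id_apply, ← integral_smul]
    simp [partialFourierIntegrand, mul_left_comm]
  · exact contDiff_infty.2 fun n =>
      (partialFourier_smooth_bound (E := E) hc n ℂ 0).1 F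
  · rintro ⟨k, n⟩
    obtain ⟨-, q, C, hqc, hC, hq⟩ := partialFourier_smooth_bound (E := E) hc n ℂ k
    obtain ⟨s, C', -, hs⟩ := Seminorm.bound_of_continuous (schwartz_withSeminorms ℂ (E × E) ℂ) q hqc
    refine ⟨s, C * C', by positivity, fun F z => (hq F z).trans ?_⟩
    rw [mul_assoc]
    exact mul_le_mul_of_nonneg_left (hs F) hC

end SchwartzTools

/-! ### Phase space and the Heisenberg group -/

/-- Configuration space `ℝᴺ` with the Euclidean structure. -/
abbrev Conf (N : ℕ) : Type := EuclideanSpace ℝ (Fin N)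

/-- Phase space `ℝ²ᴺ`; a point is `z = (x, p)` with `x = z.1` and `p = z.2`. -/
abbrev Phase (N : ℕ) : Type := Conf N × Conf N

instance (N : ℕ) : (volume : Measure (Phase N)).IsAddHaarMeasure :=
  inferInstanceAs ((volume : Measure (Conf N)).prod (volume : Measure (Conf N))).IsAddHaarMeasure

/-- The Hilbert space `L²(X)` of complex-valued functions. -/
abbrev L2 (X : Type) [MeasureSpace X] : Type := Lp ℂ 2 (volume : Measure X)

variable {N : ℕ}

/-- The symplectic product `z ∧ z' = p·x' - p'·x`. -/
def wedge (z z' : Phase N) : ℝ := inner ℝ z.2 z'.1 - inner ℝ z'.2 z.1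

/-- The Heisenberg group: pairs `(z, t)` with
`(z, t) (z', t') = (z + z', t + t' + ½ z ∧ z')`. -/
@[ext] structure Heisenberg (N : ℕ) where
  z : Phase N
  t : ℝ

namespace Heisenberg

instance : Mul (Heisenberg N) := ⟨fun g h => ⟨g.z + h.z, g.t + h.t + 1 / 2 * wedge g.z h.z⟩⟩
instance : One (Heisenberg N) := ⟨⟨0, 0⟩⟩
instance : Inv (Heisenberg N) := ⟨fun g => ⟨-g.z, -g.t⟩⟩

@[simp] theorem mul_z (g h : Heisenberg N) : (g * h).z = g.z + h.z := rfl
@[simp] theorem mul_t (g h : Heisenberg N) :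
    (g * h).t = g.t + h.t + 1 / 2 * wedge g.z h.z := rfl
@[simp] theorem one_z : (1 : Heisenberg N).z = 0 := rfl
@[simp] theorem one_t : (1 : Heisenberg N).t = 0 := rfl
@[simp] theorem inv_z (g : Heisenberg N) : g⁻¹.z = -g.z := rfl
@[simp] theorem inv_t (g : Heisenberg N) : g⁻¹.t = -g.t := rfl

instance : Group (Heisenberg N) :=
  Group.ofLeftAxioms
    (fun a b c => by
      ext1
      · simp [add_assoc]
      · simp only [mul_t, mul_z, wedge, Prod.fst_add, Prod.snd_add, inner_add_left,
          inner_add_right]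
        ring)
    (fun a => by
      ext1
      · simp
      · simp [wedge])
    (fun a => by
      ext1
      · simp
      · simp [wedge])

/-- The topology of `ℝ²ᴺ × ℝ`. -/
instance : TopologicalSpace (Heisenberg N) :=
  TopologicalSpace.induced (fun g => (g.z, g.t)) inferInstance

end Heisenberg

/-! ### Unitary representations -/

section Representations

variable {H H₁ H₂ : Type} [NormedAddCommGroup H] [InnerProductSpace ℂ H]
  [NormedAddCommGroup H₁] [InnerProductSpace ℂ H₁]
  [NormedAddCommGroup H₂] [InnerProductSpace ℂ H₂]

/-- A homomorphism of a group into the linear isometries of a Hilbert space takes values in the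
unitary operators. -/
def unitaryOfIsometric {G : Type} [Group G] (π : G →* (H →ₗᵢ[ℂ] H)) : G →* (H ≃ₗᵢ[ℂ] H) where
  toFun g :=
    { toLinearEquiv := LinearEquiv.ofLinearMap (π g).toLinearMap (π g⁻¹).toLinearMap
        (LinearMap.ext fun v => by
          change (π g * π g⁻¹) v = v
          rw [← map_mul, mul_inv_cancel, map_one]; rfl)
        (LinearMap.ext fun v => by
          change (π g⁻¹ * π g) v = v
          rw [← map_mul, inv_mul_cancel, map_one]; rfl)
      norm_map' := fun v => (π g).norm_map v }
  map_one' := by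
    ext v
    change π 1 v = v
    rw [map_one]; rfl
  map_mul' g h := by
    ext v
    change π (g * h) v = π g (π h v)
    rw [map_mul]; rfl

@[simp] theorem unitaryOfIsometric_apply {G : Type} [Group G] (π : G →* (H →ₗᵢ[ℂ] H)) (g : G)
    (v : H) : unitaryOfIsometric π g v = π g v := rfl

/-- A homomorphism `π` of the Heisenberg group into the unitary operators of `H` is an irreducible
unitary representation: it is strongly continuous, `H ≠ 0`, and no closed subspace other than `0`
and `H` is invariant under all operators `π g`. -/
structure IsIrreducibleUnitaryRep (π : Heisenberg N →* (H ≃ₗᵢ[ℂ] H)) : Prop where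
  strongly_continuous : ∀ v : H, Continuous fun g => π g v
  nontrivial : Nontrivial H
  irreducible : ∀ K : Submodule ℂ H, IsClosed (K : Set H) → (∀ g, ∀ v ∈ K, π g v ∈ K) →
    K = ⊥ ∨ K = ⊤

/-- Unitary equivalence: a unitary bijection intertwines the two representations. -/
def UnitarilyEquivalent (π₁ : Heisenberg N →* (H₁ ≃ₗᵢ[ℂ] H₁))
    (π₂ : Heisenberg N →* (H₂ ≃ₗᵢ[ℂ] H₂)) : Prop :=
  ∃ W : H₁ ≃ₗᵢ[ℂ] H₂, ∀ g v, W (π₁ g v) = π₂ g (W v)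

end Representations

/-! ### Modulated translations on `L²` -/

section ModulatedTranslation

variable {X : Type} [NormedAddCommGroup X] [MeasureSpace X] [BorelSpace X]
  [(volume : Measure X).IsAddRightInvariant]

theorem memLp_modTranslate {θ : X → ℝ} (hθ : Continuous θ) (a : X) (f : L2 X) :
    MemLp (fun x => Complex.exp ((θ x : ℂ) * Complex.I) * f (x - a)) 2 := by
  have h := (Lp.memLp f).comp_measurePreserving (measurePreserving_sub_right volume a)
  refine h.of_le (AEStronglyMeasurable.mul ?_ h.1) (Filter.Eventually.of_forall fun x => ?_)
  · exact Measurable.aestronglyMeasurable (by fun_prop)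
  · simp [Complex.norm_exp_ofReal_mul_I]

/-- The isometry `f ↦ e^{i θ(x)} f(x - a)` of `L²(X)`. -/
def modTranslate (θ : X → ℝ) (hθ : Continuous θ) (a : X) : L2 X →ₗᵢ[ℂ] L2 X where
  toFun f := (memLp_modTranslate hθ a f).toLp _
  map_add' f g := by
    rw [← MemLp.toLp_add]
    refine MemLp.toLp_congr _ _ ?_
    filter_upwards [(measurePreserving_sub_right volume a).quasiMeasurePreserving.ae
      (Lp.coeFn_add f g)] with x hx
    simp only [Pi.add_apply] at hx ⊢
    rw [hx, mul_add]
  map_smul' c f := by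
    rw [RingHom.id_apply, ← MemLp.toLp_const_smul]
    refine MemLp.toLp_congr _ _ ?_
    filter_upwards [(measurePreserving_sub_right volume a).quasiMeasurePreserving.ae
      (Lp.coeFn_smul c f)] with x hx
    simp only [Pi.smul_apply, smul_eq_mul] at hx ⊢
    rw [hx, mul_left_comm]
  norm_map' f := by
    change ‖(memLp_modTranslate hθ a f).toLp _‖ = _
    rw [Lp.norm_toLp, Lp.norm_def]
    congr 1
    rw [← eLpNorm_comp_measurePreserving (Lp.aestronglyMeasurable f)
      (measurePreserving_sub_right volume a)]
    refine eLpNorm_congr_norm_ae (Filter.Eventually.of_forall fun x => ?_)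
    simp [Complex.norm_exp_ofReal_mul_I]

theorem coeFn_modTranslate (θ : X → ℝ) (hθ : Continuous θ) (a : X) (f : L2 X) :
    modTranslate θ hθ a f =ᵐ[volume] fun x => Complex.exp ((θ x : ℂ) * Complex.I) * f (x - a) :=
  (memLp_modTranslate hθ a f).coeFn_toLp

theorem modTranslate_mul {θ₁ θ₂ θ : X → ℝ} (h₁ : Continuous θ₁) (h₂ : Continuous θ₂)
    (h : Continuous θ) {a₁ a₂ a : X} (ha : a = a₁ + a₂)
    (hθ : ∀ x, θ x = θ₁ x + θ₂ (x - a₁)) :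
    modTranslate θ h a = modTranslate θ₁ h₁ a₁ * modTranslate θ₂ h₂ a₂ := by
  ext1 f
  refine Lp.ext ?_
  change _ =ᵐ[volume] modTranslate θ₁ h₁ a₁ (modTranslate θ₂ h₂ a₂ f)
  filter_upwards [coeFn_modTranslate θ h a f,
    coeFn_modTranslate θ₁ h₁ a₁ (modTranslate θ₂ h₂ a₂ f),
    (measurePreserving_sub_right volume a₁).quasiMeasurePreserving.ae
      (coeFn_modTranslate θ₂ h₂ a₂ f)] with x hx hx₁ hx₂
  rw [hx, hx₁, hx₂, ← mul_assoc, ← Complex.exp_add, hθ, ha, sub_sub]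
  congr 2
  push_cast
  ring

theorem modTranslate_one {θ : X → ℝ} (h : Continuous θ) {a : X} (ha : a = 0)
    (hθ : ∀ x, θ x = 0) : modTranslate θ h a = 1 := by
  ext1 f
  refine Lp.ext ?_
  filter_upwards [coeFn_modTranslate θ h a f] with x hx
  rw [hx, hθ, ha]
  simp

end ModulatedTranslation

/-! ### The Schrödinger and the phase-space representation -/

/-- `(T_Sch(z₀, t₀) f)(x) = exp[(i/ħ)(t₀ + p₀·x - ½ p₀·x₀)] f(x - x₀)`. -/
def schAction (ħ : ℝ) (g : Heisenberg N) (f : Conf N → ℂ) (x : Conf N) : ℂ :=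
  Complex.exp (((1 / ħ * (g.t + inner ℝ g.z.2 x - 1 / 2 * inner ℝ g.z.2 g.z.1) : ℝ) : ℂ)
    * Complex.I) * f (x - g.z.1)

/-- `(T_ph(z₀, t₀) F)(z) = exp[(i/ħ)(t₀ - ½ z ∧ z₀)] F(z - z₀)`. -/
def phAction (ħ : ℝ) (g : Heisenberg N) (F : Phase N → ℂ) (z : Phase N) : ℂ :=
  Complex.exp (((1 / ħ * (g.t - 1 / 2 * wedge z g.z) : ℝ) : ℂ) * Complex.I) * F (z - g.z)

/-- The Schrödinger representation of the Heisenberg group on `L²(ℝᴺ)`: the unitary operators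
`ψ ↦ schAction ħ g ψ`. -/
def tSch (ħ : ℝ) : Heisenberg N →* (L2 (Conf N) ≃ₗᵢ[ℂ] L2 (Conf N)) :=
  unitaryOfIsometric
    { toFun := fun g => modTranslate
        (fun x => 1 / ħ * (g.t + inner ℝ g.z.2 x - 1 / 2 * inner ℝ g.z.2 g.z.1))
        (by fun_prop) g.z.1
      map_one' := modTranslate_one _ (by simp) (by simp)
      map_mul' := fun g h => modTranslate_mul _ _ _ (by simp) (fun x => by
        simp only [Heisenberg.mul_t, Heisenberg.mul_z, wedge, Prod.fst_add, Prod.snd_add,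
          inner_add_left, inner_add_right, inner_sub_right]
        ring) }

theorem coeFn_tSch (ħ : ℝ) (g : Heisenberg N) (ψ : L2 (Conf N)) :
    tSch ħ g ψ =ᵐ[volume] schAction ħ g ψ :=
  coeFn_modTranslate (fun x => 1 / ħ * (g.t + inner ℝ g.z.2 x - 1 / 2 * inner ℝ g.z.2 g.z.1))
    (by fun_prop) g.z.1 ψ

/-- The phase-space representation of the Heisenberg group on `L²(ℝ²ᴺ)`: the unitary operators
`Ψ ↦ phAction ħ g Ψ`. -/
def tPh (ħ : ℝ) : Heisenberg N →* (L2 (Phase N) ≃ₗᵢ[ℂ] L2 (Phase N)) :=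
  unitaryOfIsometric
    { toFun := fun g => modTranslate
        (fun z => 1 / ħ * (g.t - 1 / 2 * wedge z g.z)) (by unfold wedge; fun_prop) g.z
      map_one' := modTranslate_one _ (by simp) (by simp [wedge])
      map_mul' := fun g h => modTranslate_mul _ _ _ (by simp) (fun x => by
        simp only [Heisenberg.mul_t, Heisenberg.mul_z, wedge, Prod.fst_add, Prod.snd_add,
          Prod.fst_sub, Prod.snd_sub,
          inner_add_left, inner_add_right, inner_sub_right, inner_sub_left]
        ring) }

theorem coeFn_tPh (ħ : ℝ) (g : Heisenberg N) (Ψ : L2 (Phase N)) :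
    tPh ħ g Ψ =ᵐ[volume] phAction ħ g Ψ :=
  coeFn_modTranslate (fun z => 1 / ħ * (g.t - 1 / 2 * wedge z g.z)) (by unfold wedge; fun_prop)
    g.z Ψ

/-! ### The Wigner wave-packet transform -/

/-- The Wigner wave-packet transform with window `φ`:
`(2πħ)^{-N/2} e^{(i/2ħ) p·x} ∫ e^{-(i/ħ) p·x'} ψ(x') φ(x - x') dx'`. -/
def wpt (ħ : ℝ) (φ ψ : Conf N → ℂ) (z : Phase N) : ℂ :=
  (((1 / (2 * Real.pi * ħ)) ^ ((N : ℝ) / 2) : ℝ) : ℂ) *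
    Complex.exp (((1 / (2 * ħ) * inner ℝ z.2 z.1 : ℝ) : ℂ) * Complex.I) *
    ∫ x', Complex.exp (((-(1 / ħ * inner ℝ z.2 x') : ℝ) : ℂ) * Complex.I) * ψ x' * φ (z.1 - x')

/-- The integral kernel of the transform, as a function of the variable of integration. -/
def wptKernel (ħ : ℝ) (φ : Conf N → ℂ) (z : Phase N) (x' : Conf N) : ℂ :=
  (((1 / (2 * Real.pi * ħ)) ^ ((N : ℝ) / 2) : ℝ) : ℂ) *
    Complex.exp (((1 / (2 * ħ) * inner ℝ z.2 z.1 : ℝ) : ℂ) * Complex.I) *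
    Complex.exp (((-(1 / ħ * inner ℝ z.2 x') : ℝ) : ℂ) * Complex.I) * φ (z.1 - x')

theorem exists_wptSchwartz (ħ : ℝ) (hħ : 0 < ħ) (φ ψ : 𝓢(Conf N, ℂ)) :
    ∃ f : 𝓢(Phase N, ℂ), ∀ z, f z = wpt ħ φ ψ z := by
  obtain ⟨L, hL⟩ := exists_partialFourierCLM (E := Conf N) (c := 1 / ħ) (by positivity)
  obtain ⟨T, hT⟩ := exists_tensor (E := Conf N) φ
  let e : (Conf N × Conf N) ≃L[ℝ] (Conf N × Conf N) :=
    LinearEquiv.toContinuousLinearEquiv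
      { toFun := fun w => (w.1 - w.2, w.2)
        invFun := fun w => (w.1 + w.2, w.2)
        map_add' := fun v w => by ext1 <;> simp; abel
        map_smul' := fun c w => by ext1 <;> simp [smul_sub]
        left_inv := fun w => by simp
        right_inv := fun w => by simp }
  have he : ∀ w, e w = (w.1 - w.2, w.2) := fun w => rfl
  have hb : Function.HasTemperateGrowth
      (fun z : Phase N => 1 / (2 * ħ) * (inner ℝ z.2 z.1 : ℝ)) := by
    have h2 : Function.HasTemperateGrowth (fun z : Phase N => z.2) :=
      (ContinuousLinearMap.snd ℝ (Conf N) (Conf N)).hasTemperateGrowth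
    have h1 : Function.HasTemperateGrowth (fun z : Phase N => z.1) :=
      (ContinuousLinearMap.fst ℝ (Conf N) (Conf N)).hasTemperateGrowth
    exact (Function.HasTemperateGrowth.const (1 / (2 * ħ))).mul
      ((innerSL ℝ (E := Conf N)).bilinear_hasTemperateGrowth h2 h1)
  have hm : Function.HasTemperateGrowth (fun z : Phase N =>
      (((1 / (2 * Real.pi * ħ)) ^ ((N : ℝ) / 2) : ℝ) : ℂ) *
      Complex.exp (((1 / (2 * ħ) * inner ℝ z.2 z.1 : ℝ) : ℂ) * Complex.I)) :=
    (Function.HasTemperateGrowth.const _).mul (hasTemperateGrowth_cexp_mul_I.comp hb)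
  refine ⟨smulLeftCLM ℂ (fun z : Phase N =>
      (((1 / (2 * Real.pi * ħ)) ^ ((N : ℝ) / 2) : ℝ) : ℂ) *
      Complex.exp (((1 / (2 * ħ) * inner ℝ z.2 z.1 : ℝ) : ℂ) * Complex.I))
    (L (compCLMOfContinuousLinearEquiv ℂ e (T ψ))), fun z => ?_⟩
  rw [smulLeftCLM_apply_apply hm, hL, wpt, smul_eq_mul]
  congr 1
  refine integral_congr_ae (Filter.Eventually.of_forall fun y => ?_)
  simp only [compCLMOfContinuousLinearEquiv_apply, Function.comp_apply, he, hT]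
  ring

/-- The Wigner wave-packet transform of a Schwartz function is a Schwartz function. -/
def wptSchwartz (ħ : ℝ) (hħ : 0 < ħ) (φ ψ : 𝓢(Conf N, ℂ)) : 𝓢(Phase N, ℂ) where
  toFun := wpt ħ φ ψ
  smooth' := by
    obtain ⟨f, hf⟩ := exists_wptSchwartz ħ hħ φ ψ
    rw [← funext hf]
    exact f.smooth ⊤
  decay' := by
    obtain ⟨f, hf⟩ := exists_wptSchwartz ħ hħ φ ψ
    rw [← funext hf]
    exact f.decay'

theorem exists_wptKernelSchwartz (ħ : ℝ) (φ : 𝓢(Conf N, ℂ)) (z : Phase N) :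
    ∃ f : 𝓢(Conf N, ℂ), ∀ x', f x' = wptKernel ħ φ z x' := by
  obtain ⟨g, hg⟩ := exists_schwartz_modulated_reflection
    ((((1 / (2 * Real.pi * ħ)) ^ ((N : ℝ) / 2) : ℝ) : ℂ) *
      Complex.exp (((1 / (2 * ħ) * inner ℝ z.2 z.1 : ℝ) : ℂ) * Complex.I)) 0
    ((-(1 / ħ)) • innerSL ℝ z.2) z.1 φ
  refine ⟨g, fun x' => ?_⟩
  rw [hg, wptKernel]
  simp

/-- The integral kernel of the transform as a Schwartz function. -/
def wptKernelSchwartz (ħ : ℝ) (φ : 𝓢(Conf N, ℂ)) (z : Phase N) : 𝓢(Conf N, ℂ) where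
  toFun := wptKernel ħ φ z
  smooth' := by
    obtain ⟨f, hf⟩ := exists_wptKernelSchwartz ħ φ z
    rw [← funext hf]
    exact f.smooth ⊤
  decay' := by
    obtain ⟨f, hf⟩ := exists_wptKernelSchwartz ħ φ z
    rw [← funext hf]
    exact f.decay'

/-- The Wigner wave-packet transform of a tempered distribution: the distribution is evaluated on
the integral kernel. -/
def wptDist (ħ : ℝ) (φ : 𝓢(Conf N, ℂ)) (T : 𝓢'(Conf N, ℂ)) (z : Phase N) : ℂ :=
  T (wptKernelSchwartz ħ φ z)

/-- On `L²` functions, viewed as tempered distributions, this is the integral transform. -/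
theorem wptDist_toTemperedDistribution (ħ : ℝ) (φ : 𝓢(Conf N, ℂ)) (ψ : L2 (Conf N)) :
    wptDist ħ φ (Lp.toTemperedDistribution ψ) = wpt ħ φ ψ := by
  ext z
  rw [wptDist, Lp.toTemperedDistribution_apply, wpt, ← integral_const_mul]
  refine integral_congr_ae (Filter.Eventually.of_forall fun x => ?_)
  change wptKernel ħ φ z x • ψ x = _
  simp only [wptKernel, smul_eq_mul]
  ring

/-! ### The symplectic Fourier transform -/

/-- The symplectic Fourier transform `(2πħ)^{-N} ∫ e^{-(i/ħ) z ∧ z'} A(z') dz'`. -/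
def symplecticFourier (ħ : ℝ) (A : Phase N → ℂ) (z : Phase N) : ℂ :=
  (((1 / (2 * Real.pi * ħ)) ^ N : ℝ) : ℂ) *
    ∫ z', Complex.exp (((-(1 / ħ * wedge z z') : ℝ) : ℂ) * Complex.I) * A z'

theorem exists_symplecticFourierCLM (ħ : ℝ) (hħ : 0 < ħ) :
    ∃ L : 𝓢(Phase N, ℂ) →L[ℂ] 𝓢(Phase N, ℂ), ∀ f z, L f z = symplecticFourier ħ f z := by
  let e : WithLp 2 (Conf N × Conf N) ≃L[ℝ] Phase N :=
    WithLp.prodContinuousLinearEquiv 2 ℝ (Conf N) (Conf N)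
  let j : Phase N ≃L[ℝ] Phase N :=
    LinearEquiv.toContinuousLinearEquiv
      { toFun := fun w => ((1 / (2 * Real.pi * ħ)) • w.2, -((1 / (2 * Real.pi * ħ)) • w.1))
        invFun := fun w => (-((2 * Real.pi * ħ) • w.2), (2 * Real.pi * ħ) • w.1)
        map_add' := fun v w => by ext1 <;> simp only [Prod.fst_add, Prod.snd_add] <;> module
        map_smul' := fun c w => by
          ext1 <;> simp only [Prod.smul_fst, Prod.smul_snd, RingHom.id_apply] <;> module
        left_inv := fun w => by
          have h : (2 * Real.pi * ħ) * (1 / (2 * Real.pi * ħ)) = 1 := by field_simp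
          ext1 <;> dsimp only <;> simp only [smul_neg, neg_neg, smul_smul, h, one_smul]
        right_inv := fun w => by
          have h : (1 / (2 * Real.pi * ħ)) * (2 * Real.pi * ħ) = 1 := by field_simp
          ext1 <;> dsimp only <;> simp only [smul_neg, neg_neg, smul_smul, h, one_smul] }
  have hj : ∀ w, j w = ((1 / (2 * Real.pi * ħ)) • w.2, -((1 / (2 * Real.pi * ħ)) • w.1)) :=
    fun w => rfl
  refine ⟨(((1 / (2 * Real.pi * ħ)) ^ N : ℝ) : ℂ) •
    (compCLMOfContinuousLinearEquiv ℂ (j.trans e.symm)).comp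
      ((FourierTransform.fourierCLM ℂ 𝓢(WithLp 2 (Conf N × Conf N), ℂ)).comp
        (compCLMOfContinuousLinearEquiv ℂ e)), fun f z => ?_⟩
  simp only [ContinuousLinearMap.comp_apply, _root_.smul_apply]
  rw [symplecticFourier, smul_eq_mul]
  congr 1
  rw [compCLMOfContinuousLinearEquiv_apply, Function.comp_apply,
    FourierTransform.fourierCLM_apply, SchwartzMap.fourier_coe, Real.fourier_eq',
    ← (WithLp.volume_preserving_toLp (Conf N) (Conf N)).integral_comp
      (MeasurableEquiv.toLp 2 (Conf N × Conf N)).measurableEmbedding]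
  refine integral_congr_ae (Filter.Eventually.of_forall fun w => ?_)
  simp only [smul_eq_mul, compCLMOfContinuousLinearEquiv_apply, Function.comp_apply]
  congr 1
  have hj' : (j.trans e.symm) z = WithLp.toLp 2 (j z) := rfl
  rw [hj', hj]
  congr 3
  simp only [WithLp.prod_inner_apply, inner_smul_right, inner_neg_right, wedge]
  rw [real_inner_comm z.2 w.1]
  have := Real.pi_ne_zero
  field_simp
  ring

/-- The symplectic Fourier transform on Schwartz functions. -/
def symplecticFourierCLM (ħ : ℝ) (hħ : 0 < ħ) : 𝓢(Phase N, ℂ) →L[ℂ] 𝓢(Phase N, ℂ) :=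
  (exists_symplecticFourierCLM ħ hħ).choose

theorem symplecticFourierCLM_apply (ħ : ℝ) (hħ : 0 < ħ) (f : 𝓢(Phase N, ℂ)) (z : Phase N) :
    symplecticFourierCLM ħ hħ f z = symplecticFourier ħ f z :=
  (exists_symplecticFourierCLM ħ hħ).choose_spec f z

/-- The symplectic Fourier transform of a tempered distribution, by duality:
`⟨F_σ A, f⟩ = ⟨A, z ↦ (F_σ f)(-z)⟩`, since `-(z ∧ z') = z' ∧ z`. -/
def symplecticFourierDist (ħ : ℝ) (hħ : 0 < ħ) (A : 𝓢'(Phase N, ℂ)) : 𝓢'(Phase N, ℂ) :=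
  PointwiseConvergenceCLM.precomp ℂ
    ((compCLMOfContinuousLinearEquiv ℂ (ContinuousLinearEquiv.neg ℝ)).comp
      (symplecticFourierCLM ħ hħ)) A

/-! ### Weyl operators -/

theorem exists_ambiguityCLM (ħ : ℝ) (hħ : 0 < ħ) (ψ : 𝓢(Conf N, ℂ)) :
    ∃ L : 𝓢(Conf N, ℂ) →L[ℂ] 𝓢(Phase N, ℂ), ∀ χ z₀,
      L χ z₀ = ∫ x, schAction ħ ⟨z₀, 0⟩ ψ x * χ x := by
  obtain ⟨L, hL⟩ := exists_partialFourierCLM (E := Conf N) (c := -(1 / ħ))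
    (neg_ne_zero.2 (by positivity))
  obtain ⟨T, hT⟩ := exists_tensor (E := Conf N) ψ
  let e : (Conf N × Conf N) ≃L[ℝ] (Conf N × Conf N) :=
    LinearEquiv.toContinuousLinearEquiv
      { toFun := fun w => (w.2 - (1 / 2 : ℝ) • w.1, w.2 + (1 / 2 : ℝ) • w.1)
        invFun := fun w => (w.2 - w.1, (1 / 2 : ℝ) • (w.1 + w.2))
        map_add' := fun v w => by ext1 <;> simp only [Prod.fst_add, Prod.snd_add] <;> module
        map_smul' := fun c w => by
          ext1 <;> simp only [Prod.smul_fst, Prod.smul_snd, RingHom.id_apply] <;> module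
        left_inv := fun w => by ext1 <;> dsimp only <;> module
        right_inv := fun w => by ext1 <;> dsimp only <;> module }
  have he : ∀ w, e w = (w.2 - (1 / 2 : ℝ) • w.1, w.2 + (1 / 2 : ℝ) • w.1) := fun w => rfl
  refine ⟨L.comp ((compCLMOfContinuousLinearEquiv ℂ e).comp T), fun χ z₀ => ?_⟩
  rw [← integral_add_right_eq_self _ ((1 / 2 : ℝ) • z₀.1)]
  simp only [ContinuousLinearMap.comp_apply]
  rw [hL]
  refine integral_congr_ae (Filter.Eventually.of_forall fun y => ?_)
  simp only [compCLMOfContinuousLinearEquiv_apply, Function.comp_apply, he, hT, schAction]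
  have h1 : y + (1 / 2 : ℝ) • z₀.1 - z₀.1 = y - (1 / 2 : ℝ) • z₀.1 := by module
  rw [h1, mul_assoc]
  congr 3
  rw [inner_add_right, inner_smul_right]
  push_cast
  ring

/-- The function `z₀ ↦ ∫ (T_Sch(z₀) ψ)(x) χ(x) dx`, as a continuous linear operator in `χ`. -/
def ambiguityCLM (ħ : ℝ) (hħ : 0 < ħ) (ψ : 𝓢(Conf N, ℂ)) :
    𝓢(Conf N, ℂ) →L[ℂ] 𝓢(Phase N, ℂ) :=
  (exists_ambiguityCLM ħ hħ ψ).choose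

theorem ambiguityCLM_apply (ħ : ℝ) (hħ : 0 < ħ) (ψ χ : 𝓢(Conf N, ℂ)) (z₀ : Phase N) :
    ambiguityCLM ħ hħ ψ χ z₀ = ∫ x, schAction ħ ⟨z₀, 0⟩ ψ x * χ x :=
  (exists_ambiguityCLM ħ hħ ψ).choose_spec χ z₀

/-- The Weyl operator `A_Sch = (2πħ)^{-N} ∫ (F_σ A)(z₀) T_Sch(z₀) dz₀` of a symbol `A`, which may be
any tempered distribution. It maps Schwartz functions to tempered distributions, and the integral is
read weakly: `⟨A_Sch ψ, χ⟩ = (2πħ)^{-N} ⟨F_σ A, z₀ ↦ ⟨T_Sch(z₀) ψ, χ⟩⟩`. -/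
def weylSch (ħ : ℝ) (hħ : 0 < ħ) (A : 𝓢'(Phase N, ℂ)) (ψ : 𝓢(Conf N, ℂ)) : 𝓢'(Conf N, ℂ) :=
  (((1 / (2 * Real.pi * ħ)) ^ N : ℝ) : ℂ) •
    PointwiseConvergenceCLM.precomp ℂ (ambiguityCLM ħ hħ ψ) (symplecticFourierDist ħ hħ A)

theorem exists_phOrbit (ħ : ℝ) (Ψ : 𝓢(Phase N, ℂ)) (z : Phase N) :
    ∃ f : 𝓢(Phase N, ℂ), ∀ z₀, f z₀ = phAction ħ ⟨z₀, 0⟩ Ψ z := by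
  obtain ⟨g, hg⟩ := exists_schwartz_modulated_reflection 1 0
    ((-(1 / (2 * ħ))) • ((innerSL ℝ z.2).comp (ContinuousLinearMap.fst ℝ (Conf N) (Conf N)) -
      (innerSL ℝ z.1).comp (ContinuousLinearMap.snd ℝ (Conf N) (Conf N)))) z Ψ
  refine ⟨g, fun z₀ => ?_⟩
  rw [hg, phAction]
  congr 1
  rw [one_mul]
  congr 3
  simp [wedge, real_inner_comm]
  ring

/-- For fixed `z`, the function `z₀ ↦ (T_ph(z₀) Ψ)(z)`. -/
def phOrbit (ħ : ℝ) (Ψ : 𝓢(Phase N, ℂ)) (z : Phase N) : 𝓢(Phase N, ℂ) where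
  toFun z₀ := phAction ħ ⟨z₀, 0⟩ Ψ z
  smooth' := by
    obtain ⟨f, hf⟩ := exists_phOrbit ħ Ψ z
    rw [← funext hf]
    exact f.smooth ⊤
  decay' := by
    obtain ⟨f, hf⟩ := exists_phOrbit ħ Ψ z
    rw [← funext hf]
    exact f.decay'

/-- The phase-space Weyl operator `(A_ph Ψ)(z) = (2πħ)^{-N} ∫ (F_σ A)(z₀) (T_ph(z₀) Ψ)(z) dz₀` of a
symbol `A`, which may be any tempered distribution: for each `z` the distribution `F_σ A` is
evaluated on the Schwartz function `z₀ ↦ (T_ph(z₀) Ψ)(z)`. -/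
def weylPh (ħ : ℝ) (hħ : 0 < ħ) (A : 𝓢'(Phase N, ℂ)) (Ψ : 𝓢(Phase N, ℂ)) (z : Phase N) : ℂ :=
  (((1 / (2 * Real.pi * ħ)) ^ N : ℝ) : ℂ) * symplecticFourierDist ħ hħ A (phOrbit ħ Ψ z)

/-- The vector-valued (Bochner) form `(2πħ)^{-N} ∫ (F_σ A)(z₀) π(z₀) v dz₀` of the Weyl operator with
symbol `A` attached to a representation `π`. -/
def weylBochner {H : Type} [NormedAddCommGroup H] [InnerProductSpace ℂ H] (ħ : ℝ)
    (π : Heisenberg N →* (H ≃ₗᵢ[ℂ] H)) (A : Phase N → ℂ) (v : H) : H :=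
  (((1 / (2 * Real.pi * ħ)) ^ N : ℝ) : ℂ) • ∫ z₀, symplecticFourier ħ A z₀ • π ⟨z₀, 0⟩ v

end

end PhaseSpaceWeyl

open PhaseSpaceWeyl

/-!
For fixed `x`, the function `p ↦ U_φ ψ (x, p)` is, up to a phase and a dilation, the Fourier
transform of `y ↦ ψ y * φ (x - y)`. Plancherel in `p` followed by integration over `x` gives the
Moyal identity `‖U_φ ψ‖² = ‖ψ‖² ‖φ‖²`, so `U_φ` extends from Schwartz functions to an isometry
of `L²`. Intertwining is a change of variables in the integral, by the covariance of the kernel of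
`U_φ` under the Heisenberg group; the Weyl operators are superpositions of the operators of the
representations, hence they are intertwined as well.

For irreducibility, a matrix coefficient `⟪χ, T_Sch(g) ψ⟫` with position shift `a` is the Fourier
transform of `x ↦ ψ (x - a) * conj (χ x)` at the frequency given by the momentum of `g`. If all of
them vanish, so do all of these products, and integrating `|ψ (x - a)|² |χ x|²` over `a` and `x`
gives `‖ψ‖ ‖χ‖ = 0`.
-/

namespace PhaseSpaceWeyl

open Filter Topology

section SquareIntegrable

variable {X E : Type*} [MeasurableSpace X] {μ : Measure X} [NormedAddCommGroup E]

theorem norm_toLp_two_sq {f : X → E} (hf : MemLp f 2 μ) : ‖hf.toLp f‖ ^ 2 = ∫ x, ‖f x‖ ^ 2 ∂μ := by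
  have hnonneg : 0 ≤ ∫ x, ‖f x‖ ^ 2 ∂μ := integral_nonneg fun x => by positivity
  rw [Lp.norm_toLp, hf.eLpNorm_eq_integral_rpow_norm two_ne_zero ENNReal.ofNat_ne_top,
    ENNReal.toReal_ofReal (by positivity)]
  simp only [ENNReal.toReal_ofNat, Real.rpow_ofNat]
  rw [← Real.rpow_mul_natCast hnonneg]
  norm_num

theorem norm_sq_eq_integral_norm_sq (f : Lp E 2 μ) : ‖f‖ ^ 2 = ∫ x, ‖f x‖ ^ 2 ∂μ := by
  rw [← norm_toLp_two_sq (Lp.memLp f), Lp.toLp_coeFn]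

theorem nontrivial_Lp_two_of_integral_norm_sq_ne_zero {f : X → E} (hf : MemLp f 2 μ)
    (h : ∫ x, ‖f x‖ ^ 2 ∂μ ≠ 0) : Nontrivial (Lp E 2 μ) := by
  refine nontrivial_of_ne (hf.toLp f) 0 fun h0 => h ?_
  rw [← norm_toLp_two_sq hf, h0, norm_zero, zero_pow two_ne_zero]

theorem integrable_norm_sq {f : X → E} (hf : MemLp f 2 μ) : Integrable (fun x => ‖f x‖ ^ 2) μ :=
  hf.integrable_norm_pow two_ne_zero

theorem norm_schwartz_toLp_two_sq {E F : Type*} [NormedAddCommGroup E] [NormedSpace ℝ E]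
    [MeasurableSpace E] [BorelSpace E] [NormedAddCommGroup F]
    [SecondCountableTopologyEither E F] [NormedSpace ℝ F] (f : 𝓢(E, F)) (μ : Measure E)
    [μ.HasTemperateGrowth] :
    ‖f.toLp 2 μ‖ ^ 2 = ∫ x, ‖f x‖ ^ 2 ∂μ :=
  norm_toLp_two_sq (f.memLp 2 μ)

end SquareIntegrable

section DenseIntegralOperator

variable {X E H S : Type*} [MeasurableSpace X] {μ : Measure X} [NormedAddCommGroup E]
  {p : ENNReal} [Fact (1 ≤ p)] [TopologicalSpace H] [FrechetUrysohnSpace H]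

theorem ae_eq_of_denseRange_of_continuous {e : S → H} (he : DenseRange e) {T : H → Lp E p μ}
    (hT : Continuous T) {k : H → X → E} (hk : ∀ x, Continuous fun v => k v x)
    (h : ∀ s, T (e s) =ᵐ[μ] k (e s)) (v : H) : T v =ᵐ[μ] k v := by
  obtain ⟨u, hu, hlim⟩ := mem_closure_iff_seq_limit.1 (he v)
  choose s hs using hu
  obtain ⟨n, hn, hae⟩ :=
    (tendstoInMeasure_of_tendsto_Lp ((hT.tendsto v).comp hlim)).exists_seq_tendsto_ae
  have hTk : ∀ᵐ x ∂μ, ∀ i, T (u i) x = k (u i) x := ae_all_iff.2 fun i => hs i ▸ h (s i)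
  filter_upwards [hae, hTk] with x hx hxk
  exact tendsto_nhds_unique hx ((((hk x).tendsto v).comp (hlim.comp hn.tendsto_atTop)).congr
    fun i => (hxk (n i)).symm)

end DenseIntegralOperator

section FourierTransform

variable {V F : Type*} [NormedAddCommGroup V] [InnerProductSpace ℝ V] [FiniteDimensional ℝ V]
  [MeasurableSpace V] [BorelSpace V] [NormedAddCommGroup F]

theorem integral_schwartz_smul_eq_zero_of_fourier_eq_zero [NormedSpace ℂ F] [CompleteSpace F]
    {f : V → F} (hf : Integrable f) (hf0 : 𝓕 f = 0) (g : 𝓢(V, ℂ)) : ∫ x, g x • f x = 0 := by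
  obtain ⟨s, rfl⟩ : ∃ s : 𝓢(V, ℂ), 𝓕 s = g := ⟨𝓕⁻ g, FourierTransform.fourier_fourierInv_eq g⟩
  calc ∫ x, (𝓕 s) x • f x = ∫ x, s x • 𝓕 f x := by
        rw [fourier_coe]
        simpa only [flip_innerₗ] using!
          VectorFourier.integral_fourierIntegral_smul_eq_flip (L := innerₗ V)
            Real.continuous_fourierChar continuous_inner (s.integrable (μ := volume)) hf
    _ = 0 := by simp [hf0]

theorem ae_eq_zero_of_fourier_eq_zero [NormedSpace ℂ F] [CompleteSpace F] {f : V → F}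
    (hf : Integrable f) (hf0 : 𝓕 f = 0) : f =ᵐ[volume] 0 := by
  refine ae_eq_zero_of_integral_contDiff_smul_eq_zero hf.locallyIntegrable fun g hg hgc => ?_
  have hgc' : HasCompactSupport (Complex.ofRealCLM ∘ g) := hgc.comp_left rfl
  simpa using integral_schwartz_smul_eq_zero_of_fourier_eq_zero hf hf0
    (hgc'.toSchwartzMap (Complex.ofRealCLM.contDiff.comp hg))

theorem integral_norm_sq_fourier_comp_smul [InnerProductSpace ℂ F] [CompleteSpace F]
    (f : 𝓢(V, F)) (r : ℝ) :
    ∫ w, ‖𝓕 f (r • w)‖ ^ 2 = |(r ^ Module.finrank ℝ V)⁻¹| * ∫ x, ‖f x‖ ^ 2 := by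
  rw [integral_comp_smul volume (fun w => ‖𝓕 f w‖ ^ 2), integral_norm_sq_fourier, smul_eq_mul]

end FourierTransform

section Convolution

variable {G E F : Type*} [AddCommGroup G] [MeasurableSpace G] [MeasurableAdd₂ G] [MeasurableNeg G]
  {μ : Measure G} [SFinite μ] [μ.IsAddRightInvariant] [NormedAddCommGroup E] [NormedAddCommGroup F]

theorem integral_integral_norm_sq_mul_norm_sq_sub {f : G → E} {g : G → F} (hf : MemLp f 2 μ)
    (hg : MemLp g 2 μ) :
    ∫ x, ∫ y, ‖f y‖ ^ 2 * ‖g (x - y)‖ ^ 2 ∂μ ∂μ = (∫ x, ‖f x‖ ^ 2 ∂μ) * ∫ x, ‖g x‖ ^ 2 ∂μ :=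
  integral_convolution (ContinuousLinearMap.mul ℝ ℝ) (integrable_norm_sq hf) (integrable_norm_sq hg)

theorem eq_zero_or_eq_zero_of_forall_ae_sub_eq_zero [μ.IsNegInvariant] {f : Lp E 2 μ}
    {g : Lp F 2 μ} (h : ∀ a, ∀ᵐ x ∂μ, f (x - a) = 0 ∨ g x = 0) : f = 0 ∨ g = 0 := by
  have hf : MemLp (fun x => f (-x)) 2 μ :=
    (Lp.memLp f).comp_measurePreserving (measurePreserving_neg μ)
  have hinner : ∀ a, ∫ x, ‖g x‖ ^ 2 * ‖f (-(a - x))‖ ^ 2 ∂μ = 0 := fun a => by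
    refine integral_eq_zero_of_ae ?_
    filter_upwards [h a] with x hx
    rw [neg_sub]
    rcases hx with hx | hx <;> simp [hx]
  have hnorm : ‖g‖ ^ 2 * ‖f‖ ^ 2 = 0 := by
    calc ‖g‖ ^ 2 * ‖f‖ ^ 2 = (∫ x, ‖g x‖ ^ 2 ∂μ) * ∫ x, ‖f (-x)‖ ^ 2 ∂μ := by
          rw [norm_sq_eq_integral_norm_sq, norm_sq_eq_integral_norm_sq,
            integral_neg_eq_self fun x => ‖f x‖ ^ 2]
      _ = 0 := by
          rw [← integral_integral_norm_sq_mul_norm_sq_sub (Lp.memLp g) hf]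
          simp only [hinner, integral_zero]
  simpa [or_comm] using hnorm

end Convolution

section IsometricExtension

variable {𝕜 S H₁ H₂ : Type*} [NormedField 𝕜] [AddCommGroup S] [Module 𝕜 S]
  [NormedAddCommGroup H₁] [NormedSpace 𝕜 H₁] [NormedAddCommGroup H₂] [NormedSpace 𝕜 H₂]
  [CompleteSpace H₂]

theorem exists_linearIsometry_extension {e : S →ₗ[𝕜] H₁} (he : DenseRange e) {T : S →ₗ[𝕜] H₂}
    (hT : ∀ s, ‖T s‖ = ‖e s‖) : ∃ U : H₁ →ₗᵢ[𝕜] H₂, ∀ s, U (e s) = T s := by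
  have hext : ∀ s, T.extendOfNorm e (e s) = T s :=
    LinearMap.extendOfNorm_eq he ⟨1, fun s => by rw [one_mul, hT]⟩
  refine ⟨⟨(T.extendOfNorm e).toLinearMap, fun v => ?_⟩, hext⟩
  exact he.induction_on (p := fun v => ‖T.extendOfNorm e v‖ = ‖v‖) v
    (isClosed_eq (by fun_prop) continuous_norm) fun s => by rw [hext, hT]

end IsometricExtension

section StrongContinuity

theorem continuous_apply_of_strongly_continuous_isometries {𝕜 G H₁ H₂ : Type*}
    [NormedField 𝕜] [TopologicalSpace G] [SeminormedAddCommGroup H₁] [NormedSpace 𝕜 H₁]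
    [SeminormedAddCommGroup H₂] [NormedSpace 𝕜 H₂] {T : G → H₁ →ₗᵢ[𝕜] H₂}
    (hT : ∀ w, Continuous fun g => T g w) {v : G → H₁} (hv : Continuous v) :
    Continuous fun g => T g (v g) := by
  refine continuous_iff_continuousAt.2 fun g₀ => tendsto_iff_norm_sub_tendsto_zero.2 ?_
  have hv₀ : Tendsto (fun g => ‖v g - v g₀‖) (𝓝 g₀) (𝓝 0) :=
    tendsto_iff_norm_sub_tendsto_zero.1 (hv.tendsto g₀)
  have hT₀ : Tendsto (fun g => ‖T g (v g₀) - T g₀ (v g₀)‖) (𝓝 g₀) (𝓝 0) :=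
    tendsto_iff_norm_sub_tendsto_zero.1 ((hT (v g₀)).tendsto g₀)
  refine squeeze_zero (fun _ => norm_nonneg _) (fun g => ?_) (add_zero (0 : ℝ) ▸ hv₀.add hT₀)
  rw [← (T g).norm_map (v g - v g₀), map_sub]
  exact norm_sub_le_norm_sub_add_norm_sub _ _ _

variable {X : Type} [NormedAddCommGroup X] [MeasureSpace X] [BorelSpace X]
  [(volume : Measure X).IsAddRightInvariant]

theorem norm_modTranslate_zero_sub_sq {θ₁ θ₂ : X → ℝ} (h₁ : Continuous θ₁) (h₂ : Continuous θ₂)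
    (f : L2 X) : ‖modTranslate θ₁ h₁ 0 f - modTranslate θ₂ h₂ 0 f‖ ^ 2 =
      ∫ x, ‖Complex.exp (θ₁ x * Complex.I) - Complex.exp (θ₂ x * Complex.I)‖ ^ 2 * ‖f x‖ ^ 2 := by
  rw [norm_sq_eq_integral_norm_sq]
  refine integral_congr_ae ?_
  filter_upwards [Lp.coeFn_sub (modTranslate θ₁ h₁ 0 f) (modTranslate θ₂ h₂ 0 f),
    coeFn_modTranslate θ₁ h₁ 0 f, coeFn_modTranslate θ₂ h₂ 0 f] with x hsub hx₁ hx₂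
  rw [hsub, Pi.sub_apply, hx₁, hx₂, sub_zero, ← sub_mul, norm_mul, mul_pow]

theorem norm_exp_mul_I_sub_sq_le (s t : ℝ) :
    ‖Complex.exp (s * Complex.I) - Complex.exp (t * Complex.I)‖ ^ 2 ≤ 4 := by
  have h := norm_sub_le (Complex.exp (s * Complex.I)) (Complex.exp (t * Complex.I))
  rw [Complex.norm_exp_ofReal_mul_I, Complex.norm_exp_ofReal_mul_I] at h
  calc _ ≤ ((1 : ℝ) + 1) ^ 2 := by gcongr
    _ = 4 := by norm_num

theorem modTranslate_eq_comp_translate {θ : X → ℝ} (hθ : Continuous θ) (a : X) (f : L2 X) :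
    modTranslate θ hθ a f = modTranslate θ hθ 0
      (Lp.compMeasurePreserving (· - a) (measurePreserving_sub_right volume a) f) := by
  refine Lp.ext ?_
  filter_upwards [coeFn_modTranslate θ hθ a f, coeFn_modTranslate θ hθ 0
      (Lp.compMeasurePreserving (· - a) (measurePreserving_sub_right volume a) f),
    Lp.coeFn_compMeasurePreserving f (measurePreserving_sub_right volume a)] with x h h₁ h₂
  rw [h, h₁, sub_zero, h₂, Function.comp_apply]

variable {G : Type*} [TopologicalSpace G]

theorem continuous_translate [IsLocallyFiniteMeasure (volume : Measure X)]
    [(volume : Measure X).InnerRegularCompactLTTop] {a : G → X} (ha : Continuous a) (f : L2 X) :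
    Continuous fun g =>
      Lp.compMeasurePreserving (· - a g) (measurePreserving_sub_right volume (a g)) f := by
  let τ : C(G, C(X, X)) := ContinuousMap.curry ⟨fun w : G × X => w.2 - a w.1, by fun_prop⟩
  exact (continuous_const (y := f)).compMeasurePreservingLp τ.continuous
    (fun g => measurePreserving_sub_right volume (a g)) (by simp)

variable [FirstCountableTopology G] {θ : G → X → ℝ}

theorem continuous_modulation (hθ : ∀ g, Continuous (θ g)) (hθ' : ∀ x, Continuous fun g => θ g x)
    (f : L2 X) : Continuous fun g => modTranslate (θ g) (hθ g) 0 f := by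
  refine continuous_iff_continuousAt.2 fun g₀ => tendsto_iff_norm_sub_tendsto_zero.2 ?_
  have hf := integrable_norm_sq (Lp.memLp f)
  have hsq : Continuous fun g => ‖modTranslate (θ g) (hθ g) 0 f -
      modTranslate (θ g₀) (hθ g₀) 0 f‖ ^ 2 := by
    simp_rw [norm_modTranslate_zero_sub_sq]
    refine continuous_of_dominated (bound := fun x => 4 * ‖f x‖ ^ 2) (fun g => ?_)
      (fun g => .of_forall fun x => ?_) (hf.const_mul 4) (.of_forall fun x => ?_)
    · have := (hθ g).measurable
      have := (hθ g₀).measurable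
      exact Measurable.aestronglyMeasurable (by fun_prop) |>.mul hf.1
    · rw [Real.norm_of_nonneg (by positivity)]
      gcongr
      exact norm_exp_mul_I_sub_sq_le _ _
    · have := hθ' x
      fun_prop
  simpa using (hsq.tendsto g₀).sqrt

theorem continuous_modTranslate [IsLocallyFiniteMeasure (volume : Measure X)]
    [(volume : Measure X).InnerRegularCompactLTTop] (hθ : ∀ g, Continuous (θ g))
    (hθ' : ∀ x, Continuous fun g => θ g x) {a : G → X} (ha : Continuous a) (f : L2 X) :
    Continuous fun g => modTranslate (θ g) (hθ g) (a g) f := by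
  refine (continuous_apply_of_strongly_continuous_isometries (continuous_modulation hθ hθ')
    (continuous_translate ha f)).congr fun g => ?_
  exact (modTranslate_eq_comp_translate (hθ g) (a g) f).symm

end StrongContinuity

section HeisenbergGroup

variable {N : ℕ}

theorem Heisenberg.isInducing_coordinates :
    Topology.IsInducing fun g : Heisenberg N => (g.z, g.t) := ⟨rfl⟩

instance : FirstCountableTopology (Heisenberg N) :=
  Heisenberg.isInducing_coordinates.firstCountableTopology

theorem Heisenberg.continuous_z : Continuous fun g : Heisenberg N => g.z :=
  continuous_fst.comp Heisenberg.isInducing_coordinates.continuous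

theorem Heisenberg.continuous_t : Continuous fun g : Heisenberg N => g.t :=
  continuous_snd.comp Heisenberg.isInducing_coordinates.continuous

theorem continuous_tSch (ħ : ℝ) (ψ : L2 (Conf N)) : Continuous fun g => tSch ħ g ψ := by
  have hz := Heisenberg.continuous_z (N := N)
  have ht := Heisenberg.continuous_t (N := N)
  let θ : Heisenberg N → Conf N → ℝ :=
    fun g x => 1 / ħ * (g.t + inner ℝ g.z.2 x - 1 / 2 * inner ℝ g.z.2 g.z.1)
  have hθ : ∀ g, Continuous (θ g) := fun g => by fun_prop
  have hθ' : ∀ x, Continuous fun g => θ g x := fun x => by fun_prop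
  exact continuous_modTranslate hθ hθ' hz.fst ψ

end HeisenbergGroup

section Representations

variable {N : ℕ} {H H₁ H₂ : Type}
  [NormedAddCommGroup H] [InnerProductSpace ℂ H]
  [NormedAddCommGroup H₁] [InnerProductSpace ℂ H₁] [NormedAddCommGroup H₂] [InnerProductSpace ℂ H₂]

theorem isIrreducibleUnitaryRep_of_inner_ne_zero [CompleteSpace H] [Nontrivial H]
    {π : Heisenberg N →* (H ≃ₗᵢ[ℂ] H)} (hπ : ∀ v, Continuous fun g => π g v)
    (hinner : ∀ v ≠ 0, ∀ w ≠ 0, ∃ g, inner ℂ w (π g v) ≠ 0) : IsIrreducibleUnitaryRep π where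
  strongly_continuous := hπ
  nontrivial := inferInstance
  irreducible K hK hinv := by
    refine or_iff_not_imp_left.2 fun hbot => ?_
    obtain ⟨v, hv, hv0⟩ := Submodule.exists_mem_ne_zero_of_ne_bot hbot
    have : CompleteSpace K := hK.completeSpace_coe
    rw [← Submodule.orthogonal_eq_bot_iff, Submodule.eq_bot_iff]
    by_contra! ⟨w, hw, hw0⟩
    obtain ⟨g, hg⟩ := hinner v hv0 w hw0
    exact hg (Submodule.inner_left_of_mem_orthogonal (hinv g v hv) hw)

theorem IsIrreducibleUnitaryRep.of_unitarilyEquivalent {π₁ : Heisenberg N →* (H₁ ≃ₗᵢ[ℂ] H₁)}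
    {π₂ : Heisenberg N →* (H₂ ≃ₗᵢ[ℂ] H₂)} (hπ : IsIrreducibleUnitaryRep π₁)
    (he : UnitarilyEquivalent π₁ π₂) : IsIrreducibleUnitaryRep π₂ := by
  obtain ⟨W, hW⟩ := he
  have hπ₂ : ∀ g v, π₂ g v = W (π₁ g (W.symm v)) := fun g v => by rw [hW, W.apply_symm_apply]
  refine ⟨fun v => ?_, ?_, fun K hK hinv => ?_⟩
  · simpa only [hπ₂, Function.comp_def] using
      W.continuous.comp (hπ.strongly_continuous (W.symm v))
  · have := hπ.nontrivial
    exact W.symm.toEquiv.nontrivial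
  · let comap := (Submodule.orderIsoMapComap W.toLinearEquiv).symm
    have hcomap : comap K = ⊥ ∨ comap K = ⊤ := hπ.irreducible (comap K)
      (hK.preimage W.continuous) fun g v hv => show W (π₁ g v) ∈ K from hW g v ▸ hinv g _ hv
    rwa [_root_.map_eq_bot_iff, _root_.map_eq_top_iff] at hcomap

/-- The representation `g ↦ W π(g) W⁻¹` obtained by transporting the unitary representation `π`
along a unitary map `W`. It is used for the isometry of a Hilbert space onto the range of an
intertwining operator. -/
def conjRep {G : Type*} [Group G] (W : H₁ ≃ₗᵢ[ℂ] H₂) (π : G →* (H₁ ≃ₗᵢ[ℂ] H₁)) :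
    G →* (H₂ ≃ₗᵢ[ℂ] H₂) where
  toFun g := (W.symm.trans (π g)).trans W
  map_one' := by ext1 v; simp
  map_mul' g h := by ext1 v; simp

theorem conjRep_apply {G : Type*} [Group G] (W : H₁ ≃ₗᵢ[ℂ] H₂) (π : G →* (H₁ ≃ₗᵢ[ℂ] H₁)) (g : G)
    (v : H₂) : conjRep W π g v = W (π g (W.symm v)) := rfl

theorem unitarilyEquivalent_conjRep (W : H₁ ≃ₗᵢ[ℂ] H₂) (π : Heisenberg N →* (H₁ ≃ₗᵢ[ℂ] H₁)) :
    UnitarilyEquivalent π (conjRep W π) :=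
  ⟨W, fun g v => by rw [conjRep_apply, W.symm_apply_apply]⟩

theorem coe_conjRep_equivRange {G : Type*} [Group G] {π₁ : G →* (H₁ ≃ₗᵢ[ℂ] H₁)}
    {π₂ : G →* (H₂ ≃ₗᵢ[ℂ] H₂)} {U : H₁ →ₗᵢ[ℂ] H₂} (hU : ∀ g v, π₂ g (U v) = U (π₁ g v))
    (g : G) (w : LinearMap.range U.toLinearMap) :
    (conjRep U.equivRange π₁ g w : H₂) = π₂ g w := by
  obtain ⟨v, rfl⟩ := U.equivRange.surjective w
  rw [conjRep_apply, LinearIsometryEquiv.symm_apply_apply]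
  exact (hU g v).symm

theorem weylBochner_apply_of_intertwining [CompleteSpace H₁] [CompleteSpace H₂] (ħ : ℝ)
    {π₁ : Heisenberg N →* (H₁ ≃ₗᵢ[ℂ] H₁)}
    {π₂ : Heisenberg N →* (H₂ ≃ₗᵢ[ℂ] H₂)} {U : H₁ →ₗᵢ[ℂ] H₂}
    (hU : ∀ g v, π₂ g (U v) = U (π₁ g v)) (A : Phase N → ℂ) (v : H₁) :
    weylBochner ħ π₂ A (U v) = U (weylBochner ħ π₁ A v) := by
  simp only [weylBochner, hU, map_smul, ← U.integral_comp_comm]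

end Representations

section Transform

variable {N : ℕ}

theorem wpt_congr (ħ : ℝ) (φ : Conf N → ℂ) {ψ₁ ψ₂ : Conf N → ℂ} (h : ψ₁ =ᵐ[volume] ψ₂) :
    wpt ħ φ ψ₁ = wpt ħ φ ψ₂ := by
  ext z
  rw [wpt, wpt]
  congr 1
  refine integral_congr_ae ?_
  filter_upwards [h] with x hx
  rw [hx]

theorem wpt_eq_integral_wptKernel_mul (ħ : ℝ) (φ ψ : Conf N → ℂ) (z : Phase N) :
    wpt ħ φ ψ z = ∫ x, wptKernel ħ φ z x * ψ x := by
  rw [wpt, ← integral_const_mul]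
  refine integral_congr_ae (.of_forall fun x => ?_)
  simp only [wptKernel]
  ring

theorem wptKernel_eq (ħ : ℝ) (φ : Conf N → ℂ) (z : Phase N) (x : Conf N) :
    wptKernel ħ φ z x = ((1 / (2 * Real.pi * ħ)) ^ ((N : ℝ) / 2) : ℝ) *
      Complex.exp ((1 / ħ * (1 / 2 * inner ℝ z.2 z.1 - inner ℝ z.2 x) : ℝ) * Complex.I) *
      φ (z.1 - x) := by
  rw [wptKernel, mul_assoc (Complex.ofReal _), ← Complex.exp_add]
  congr 3
  push_cast
  ring

theorem exp_mul_wptKernel_sub (ħ : ℝ) (φ : Conf N → ℂ) (g : Heisenberg N) (z : Phase N)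
    (x : Conf N) :
    Complex.exp ((1 / ħ * (g.t - 1 / 2 * wedge z g.z) : ℝ) * Complex.I) *
        wptKernel ħ φ (z - g.z) x =
      wptKernel ħ φ z (x + g.z.1) * Complex.exp ((1 / ħ * (g.t + inner ℝ g.z.2 (x + g.z.1) -
        1 / 2 * inner ℝ g.z.2 g.z.1) : ℝ) * Complex.I) := by
  have hphase : g.t - 1 / 2 * wedge z g.z + (1 / 2 * inner ℝ (z - g.z).2 (z - g.z).1 -
        inner ℝ (z - g.z).2 x) =
      1 / 2 * inner ℝ z.2 z.1 - inner ℝ z.2 (x + g.z.1) +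
        (g.t + inner ℝ g.z.2 (x + g.z.1) - 1 / 2 * inner ℝ g.z.2 g.z.1) := by
    simp only [wedge, Prod.fst_sub, Prod.snd_sub, inner_sub_left, inner_sub_right,
      inner_add_right]
    ring
  have hφ : φ ((z - g.z).1 - x) = φ (z.1 - (x + g.z.1)) := by
    rw [Prod.fst_sub, sub_sub, add_comm x]
  have hexp : ∀ s t : ℝ, Complex.exp ((1 / ħ * s : ℝ) * Complex.I) *
      Complex.exp ((1 / ħ * t : ℝ) * Complex.I) =
      Complex.exp ((1 / ħ * (s + t) : ℝ) * Complex.I) := fun s t => by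
    rw [← Complex.exp_add, ← add_mul, ← Complex.ofReal_add, ← mul_add]
  rw [wptKernel_eq, wptKernel_eq, hφ]
  linear_combination (((1 / (2 * Real.pi * ħ)) ^ ((N : ℝ) / 2) : ℝ) : ℂ) *
    φ (z.1 - (x + g.z.1)) * ((hexp _ _).trans ((congrArg (fun s : ℝ =>
      Complex.exp ((1 / ħ * s : ℝ) * Complex.I)) hphase).trans (hexp _ _).symm))

theorem phAction_wpt (ħ : ℝ) (φ ψ : Conf N → ℂ) (g : Heisenberg N) :
    phAction ħ g (wpt ħ φ ψ) = wpt ħ φ (schAction ħ g ψ) := by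
  ext z
  calc phAction ħ g (wpt ħ φ ψ) z
      = ∫ x, Complex.exp ((1 / ħ * (g.t - 1 / 2 * wedge z g.z) : ℝ) * Complex.I) *
          (wptKernel ħ φ (z - g.z) x * ψ x) := by
        rw [phAction, wpt_eq_integral_wptKernel_mul, integral_const_mul]
    _ = ∫ x, wptKernel ħ φ z (x + g.z.1) * schAction ħ g ψ (x + g.z.1) := by
        simp only [← mul_assoc, exp_mul_wptKernel_sub, schAction, add_sub_cancel_right]
    _ = wpt ħ φ (schAction ħ g ψ) z := by
        rw [wpt_eq_integral_wptKernel_mul,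
          integral_add_right_eq_self fun x => wptKernel ħ φ z x * schAction ħ g ψ x]

end Transform

section Isometry

variable {N : ℕ}

theorem exists_schwartz_mul_reflection {D : Type} [NormedAddCommGroup D] [NormedSpace ℝ D]
    (φ ψ : 𝓢(D, ℂ)) (x : D) : ∃ s : 𝓢(D, ℂ), ∀ y, s y = ψ y * φ (x - y) := by
  obtain ⟨g, hg⟩ := exists_schwartz_modulated_reflection 1 0 0 x φ
  refine ⟨smulLeftCLM ℂ ψ g, fun y => ?_⟩
  rw [smulLeftCLM_apply_apply ψ.hasTemperateGrowth, hg]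
  simp

theorem wpt_eq_fourier (ħ : ℝ) (φ ψ : Conf N → ℂ) (z : Phase N) :
    wpt ħ φ ψ z = (((1 / (2 * Real.pi * ħ)) ^ ((N : ℝ) / 2) : ℝ) : ℂ) *
      Complex.exp (((1 / (2 * ħ) * inner ℝ z.2 z.1 : ℝ) : ℂ) * Complex.I) *
      𝓕 (fun y => ψ y * φ (z.1 - y)) ((1 / (2 * Real.pi * ħ)) • z.2) := by
  rw [wpt, Real.fourier_eq']
  congr 1
  refine integral_congr_ae (.of_forall fun y => ?_)
  simp only [smul_eq_mul, mul_assoc]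
  congr 3
  rw [inner_smul_right, real_inner_comm]
  have := Real.pi_ne_zero
  push_cast
  field_simp

theorem norm_wpt_sq {ħ : ℝ} (hħ : 0 < ħ) (φ ψ : Conf N → ℂ) (z : Phase N) :
    ‖wpt ħ φ ψ z‖ ^ 2 = (1 / (2 * Real.pi * ħ)) ^ N *
      ‖𝓕 (fun y => ψ y * φ (z.1 - y)) ((1 / (2 * Real.pi * ħ)) • z.2)‖ ^ 2 := by
  have hr : 0 < 1 / (2 * Real.pi * ħ) := by positivity
  have hconst : ((1 / (2 * Real.pi * ħ)) ^ ((N : ℝ) / 2)) ^ 2 = (1 / (2 * Real.pi * ħ)) ^ N := by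
    rw [← Real.rpow_mul_natCast hr.le, Nat.cast_ofNat, div_mul_cancel₀ _ two_ne_zero,
      Real.rpow_natCast]
  rw [wpt_eq_fourier, norm_mul, norm_mul, Complex.norm_exp_ofReal_mul_I, mul_one,
    Complex.norm_real, Real.norm_of_nonneg (by positivity), mul_pow, hconst]

theorem integral_norm_sq_wpt_snd {ħ : ℝ} (hħ : 0 < ħ) (φ ψ : 𝓢(Conf N, ℂ)) (x : Conf N) :
    ∫ p, ‖wpt ħ φ ψ (x, p)‖ ^ 2 = ∫ y, ‖ψ y‖ ^ 2 * ‖φ (x - y)‖ ^ 2 := by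
  obtain ⟨s, hs⟩ := exists_schwartz_mul_reflection φ ψ x
  calc ∫ p, ‖wpt ħ φ ψ (x, p)‖ ^ 2
      = (1 / (2 * Real.pi * ħ)) ^ N * ∫ p, ‖𝓕 s ((1 / (2 * Real.pi * ħ)) • p)‖ ^ 2 := by
        simp_rw [norm_wpt_sq hħ, ← hs, integral_const_mul, fourier_coe]
    _ = ∫ y, ‖s y‖ ^ 2 := by
        rw [integral_norm_sq_fourier_comp_smul, finrank_euclideanSpace_fin,
          abs_of_pos (by positivity), mul_inv_cancel_left₀ (by positivity)]
    _ = ∫ y, ‖ψ y‖ ^ 2 * ‖φ (x - y)‖ ^ 2 := by simp_rw [hs, norm_mul, mul_pow]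

theorem coe_wptSchwartz {ħ : ℝ} (hħ : 0 < ħ) (φ ψ : 𝓢(Conf N, ℂ)) :
    ⇑(wptSchwartz ħ hħ φ ψ) = wpt ħ φ ψ := rfl

theorem integral_norm_sq_wpt {ħ : ℝ} (hħ : 0 < ħ) (φ ψ : 𝓢(Conf N, ℂ)) :
    ∫ z, ‖wpt ħ φ ψ z‖ ^ 2 = (∫ x, ‖ψ x‖ ^ 2) * ∫ x, ‖φ x‖ ^ 2 := by
  have hint : Integrable (fun z : Phase N => ‖wpt ħ φ ψ z‖ ^ 2) :=
    coe_wptSchwartz hħ φ ψ ▸ integrable_norm_sq ((wptSchwartz ħ hħ φ ψ).memLp 2)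
  calc ∫ z, ‖wpt ħ φ ψ z‖ ^ 2 = ∫ x, ∫ p, ‖wpt ħ φ ψ (x, p)‖ ^ 2 := integral_prod _ hint
    _ = ∫ x, ∫ y, ‖ψ y‖ ^ 2 * ‖φ (x - y)‖ ^ 2 := by simp_rw [integral_norm_sq_wpt_snd hħ]
    _ = (∫ x, ‖ψ x‖ ^ 2) * ∫ x, ‖φ x‖ ^ 2 :=
      integral_integral_norm_sq_mul_norm_sq_sub (ψ.memLp 2) (φ.memLp 2)

theorem norm_toLp_wptSchwartz {ħ : ℝ} (hħ : 0 < ħ) {φ : 𝓢(Conf N, ℂ)}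
    (hφ : ∫ x, ‖φ x‖ ^ 2 = 1) (ψ : 𝓢(Conf N, ℂ)) :
    ‖(wptSchwartz ħ hħ φ ψ).toLp 2‖ = ‖ψ.toLp 2‖ := by
  rw [← sq_eq_sq₀ (norm_nonneg _) (norm_nonneg _), norm_schwartz_toLp_two_sq,
    norm_schwartz_toLp_two_sq, coe_wptSchwartz, integral_norm_sq_wpt hħ, hφ, mul_one]

theorem integrable_wptKernel_mul (ħ : ℝ) (φ ψ : 𝓢(Conf N, ℂ)) (z : Phase N) :
    Integrable fun x => wptKernel ħ φ z x * ψ x :=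
  ((wptKernelSchwartz ħ φ z).memLp 2).integrable_mul (ψ.memLp 2)

theorem wptSchwartz_add {ħ : ℝ} (hħ : 0 < ħ) (φ ψ χ : 𝓢(Conf N, ℂ)) :
    wptSchwartz ħ hħ φ (ψ + χ) = wptSchwartz ħ hħ φ ψ + wptSchwartz ħ hħ φ χ := by
  ext z
  change wpt ħ φ (ψ + χ) z = wpt ħ φ ψ z + wpt ħ φ χ z
  simp only [wpt_eq_integral_wptKernel_mul, Pi.add_apply, mul_add]
  exact integral_add (integrable_wptKernel_mul ħ φ ψ z) (integrable_wptKernel_mul ħ φ χ z)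

theorem wptSchwartz_smul {ħ : ℝ} (hħ : 0 < ħ) (c : ℂ) (φ ψ : 𝓢(Conf N, ℂ)) :
    wptSchwartz ħ hħ φ (c • ψ) = c • wptSchwartz ħ hħ φ ψ := by
  ext z
  change wpt ħ φ (c • ψ) z = c • wpt ħ φ ψ z
  simp only [wpt_eq_integral_wptKernel_mul, Pi.smul_apply, mul_smul_comm]
  exact integral_smul c _

theorem continuous_wpt_apply (ħ : ℝ) (φ : 𝓢(Conf N, ℂ)) (z : Phase N) :
    Continuous fun ψ : L2 (Conf N) => wpt ħ φ ψ z := by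
  simp_rw [← wptDist_toTemperedDistribution, wptDist]
  exact (PointwiseConvergenceCLM.evalCLM (RingHom.id ℂ) ℂ (wptKernelSchwartz ħ φ z)).continuous.comp
    (Lp.toTemperedDistributionCLM ℂ volume 2).continuous

theorem denseRange_schwartz_toLp :
    DenseRange fun ψ : 𝓢(Conf N, ℂ) => (ψ.toLp 2 : L2 (Conf N)) :=
  denseRange_toLpCLM ENNReal.ofNat_ne_top

theorem exists_linearIsometry_toLp_wptSchwartz {ħ : ℝ} (hħ : 0 < ħ) {φ : 𝓢(Conf N, ℂ)}
    (hφ : ∫ x, ‖φ x‖ ^ 2 = 1) : ∃ U : L2 (Conf N) →ₗᵢ[ℂ] L2 (Phase N),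
      ∀ ψ : 𝓢(Conf N, ℂ), U (ψ.toLp 2) = (wptSchwartz ħ hħ φ ψ).toLp 2 := by
  let W : 𝓢(Conf N, ℂ) →ₗ[ℂ] 𝓢(Phase N, ℂ) :=
    { toFun := wptSchwartz ħ hħ φ
      map_add' := wptSchwartz_add hħ φ
      map_smul' := fun c => wptSchwartz_smul hħ c φ }
  exact exists_linearIsometry_extension
    (e := (toLpCLM ℂ ℂ 2 (volume : Measure (Conf N))).toLinearMap) denseRange_schwartz_toLp
    (T := (toLpCLM ℂ ℂ 2 (volume : Measure (Phase N))).toLinearMap ∘ₗ W)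
    (norm_toLp_wptSchwartz hħ hφ)

theorem exists_wptIsometry {ħ : ℝ} (hħ : 0 < ħ) {φ : 𝓢(Conf N, ℂ)} (hφ : ∫ x, ‖φ x‖ ^ 2 = 1) :
    ∃ U : L2 (Conf N) →ₗᵢ[ℂ] L2 (Phase N), ∀ ψ, U ψ =ᵐ[volume] wpt ħ φ ψ := by
  obtain ⟨U, hU⟩ := exists_linearIsometry_toLp_wptSchwartz hħ hφ
  refine ⟨U, ae_eq_of_denseRange_of_continuous denseRange_schwartz_toLp U.continuous
    (continuous_wpt_apply ħ φ) fun ψ => ?_⟩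
  rw [hU, wpt_congr ħ φ (ψ.coeFn_toLp 2 volume), ← coe_wptSchwartz hħ]
  exact (wptSchwartz ħ hħ φ ψ).coeFn_toLp 2 volume

end Isometry

section Irreducibility

variable {N : ℕ}

theorem fourier_translate_mul_star {ħ : ℝ} (hħ : ħ ≠ 0) (χ ψ : L2 (Conf N)) (a w : Conf N) :
    𝓕 (fun x => ψ (x - a) * star (χ x)) w =
      inner ℂ χ (tSch ħ ⟨(a, -((2 * Real.pi * ħ) • w)),
        1 / 2 * inner ℝ (-((2 * Real.pi * ħ) • w)) a⟩ ψ) := by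
  rw [L2.inner_def, Real.fourier_eq']
  refine integral_congr_ae ?_
  filter_upwards [coeFn_tSch ħ ⟨(a, -((2 * Real.pi * ħ) • w)),
    1 / 2 * inner ℝ (-((2 * Real.pi * ħ) • w)) a⟩ ψ] with x hx
  have hphase : 1 / ħ * (1 / 2 * inner ℝ (-((2 * Real.pi * ħ) • w)) a +
        inner ℝ (-((2 * Real.pi * ħ) • w)) x -
        1 / 2 * inner ℝ (-((2 * Real.pi * ħ) • w)) a) = -2 * Real.pi * inner ℝ x w := by
    rw [add_sub_cancel_left, inner_neg_left, real_inner_smul_left, real_inner_comm]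
    field_simp
  rw [hx, schAction, hphase, RCLike.inner_apply, starRingEnd_apply, smul_eq_mul, ← mul_assoc]

theorem ae_eq_zero_or_eq_zero_of_inner_tSch_eq_zero {ħ : ℝ} (hħ : ħ ≠ 0) {ψ χ : L2 (Conf N)}
    (h : ∀ g, inner ℂ χ (tSch ħ g ψ) = 0) (a : Conf N) :
    ∀ᵐ x, ψ (x - a) = 0 ∨ χ x = 0 := by
  have hshift : MemLp (fun x => ψ (x - a)) 2 volume :=
    (Lp.memLp ψ).comp_measurePreserving (measurePreserving_sub_right volume a)
  have hfourier : 𝓕 (fun x => ψ (x - a) * star (χ x)) = 0 := by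
    ext w
    rw [fourier_translate_mul_star hħ, h, Pi.zero_apply]
  filter_upwards [ae_eq_zero_of_fourier_eq_zero (hshift.integrable_mul (Lp.memLp χ).star)
    hfourier] with x hx
  simpa only [Pi.mul_apply, Pi.star_apply, Pi.zero_apply, mul_eq_zero, star_eq_zero] using hx

theorem isIrreducibleUnitaryRep_tSch {ħ : ℝ} (hħ : ħ ≠ 0) [Nontrivial (L2 (Conf N))] :
    IsIrreducibleUnitaryRep (tSch (N := N) ħ) := by
  refine isIrreducibleUnitaryRep_of_inner_ne_zero (continuous_tSch ħ) fun ψ hψ χ hχ => ?_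
  by_contra! h
  exact (eq_zero_or_eq_zero_of_forall_ae_sub_eq_zero
    (ae_eq_zero_or_eq_zero_of_inner_tSch_eq_zero hħ h)).elim hψ hχ

end Irreducibility

section Intertwining

variable {N : ℕ} {ħ : ℝ} {φ : 𝓢(Conf N, ℂ)} {U : L2 (Conf N) →ₗᵢ[ℂ] L2 (Phase N)}

theorem tPh_intertwining (hU : ∀ ψ, U ψ =ᵐ[volume] wpt ħ φ ψ) (g : Heisenberg N)
    (ψ : L2 (Conf N)) : tPh ħ g (U ψ) = U (tSch ħ g ψ) := by
  have hphAction : phAction ħ g (U ψ) =ᵐ[volume] phAction ħ g (wpt ħ φ ψ) := by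
    filter_upwards [(measurePreserving_sub_right volume g.z).quasiMeasurePreserving.ae (hU ψ)]
      with z hz
    rw [phAction, phAction, hz]
  refine Lp.ext ?_
  calc ⇑(tPh ħ g (U ψ)) =ᵐ[volume] phAction ħ g (U ψ) := coeFn_tPh ħ g (U ψ)
    _ =ᵐ[volume] phAction ħ g (wpt ħ φ ψ) := hphAction
    _ = wpt ħ φ (schAction ħ g ψ) := phAction_wpt ħ φ ψ g
    _ = wpt ħ φ (tSch ħ g ψ) := (wpt_congr ħ φ (coeFn_tSch ħ g ψ)).symm
    _ =ᵐ[volume] U (tSch ħ g ψ) := (hU _).symm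

theorem phOrbit_wptSchwartz (hħ : 0 < ħ) (φ ψ : 𝓢(Conf N, ℂ)) (z : Phase N) :
    phOrbit ħ (wptSchwartz ħ hħ φ ψ) z = ambiguityCLM ħ hħ ψ (wptKernelSchwartz ħ φ z) := by
  ext z₀
  calc phAction ħ ⟨z₀, 0⟩ (wpt ħ φ ψ) z
      = ∫ x, wptKernel ħ φ z x * schAction ħ ⟨z₀, 0⟩ ψ x := by
        rw [phAction_wpt, wpt_eq_integral_wptKernel_mul]
    _ = ∫ x, schAction ħ ⟨z₀, 0⟩ ψ x * wptKernel ħ φ z x := by simp only [mul_comm]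
    _ = ambiguityCLM ħ hħ ψ (wptKernelSchwartz ħ φ z) z₀ :=
        (ambiguityCLM_apply ħ hħ ψ (wptKernelSchwartz ħ φ z) z₀).symm

theorem weylPh_wptSchwartz (hħ : 0 < ħ) (φ : 𝓢(Conf N, ℂ)) (A : 𝓢'(Phase N, ℂ))
    (ψ : 𝓢(Conf N, ℂ)) :
    weylPh ħ hħ A (wptSchwartz ħ hħ φ ψ) = wptDist ħ φ (weylSch ħ hħ A ψ) := by
  ext z
  rw [weylPh, phOrbit_wptSchwartz]
  rfl

theorem apply_toLp_eq_toLp_wptSchwartz (hħ : 0 < ħ) (hU : ∀ ψ, U ψ =ᵐ[volume] wpt ħ φ ψ)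
    (ψ : 𝓢(Conf N, ℂ)) : U (ψ.toLp 2) = (wptSchwartz ħ hħ φ ψ).toLp 2 := by
  refine Lp.ext ((hU _).trans ?_)
  rw [wpt_congr ħ φ (ψ.coeFn_toLp 2 volume)]
  exact ((wptSchwartz ħ hħ φ ψ).coeFn_toLp 2 volume).symm

theorem wptDist_eq_wpt {T : 𝓢'(Conf N, ℂ)} {f : Conf N → ℂ}
    (hT : ∀ χ : 𝓢(Conf N, ℂ), T χ = ∫ x, f x * χ x) : wptDist ħ φ T = wpt ħ φ f := by
  ext z
  rw [wptDist, hT, wpt_eq_integral_wptKernel_mul]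
  exact integral_congr_ae (.of_forall fun x => mul_comm _ _)

theorem weyl_extension_intertwining (hħ : 0 < ħ) (hU : ∀ ψ, U ψ =ᵐ[volume] wpt ħ φ ψ)
    {A : 𝓢'(Phase N, ℂ)} {B : L2 (Conf N) →L[ℂ] L2 (Conf N)}
    {B' : L2 (Phase N) →L[ℂ] L2 (Phase N)}
    (hB : ∀ ψ χ : 𝓢(Conf N, ℂ), weylSch ħ hħ A ψ χ = ∫ x, B (ψ.toLp 2) x * χ x)
    (hB' : ∀ Ψ : 𝓢(Phase N, ℂ), B' (Ψ.toLp 2) =ᵐ[volume] weylPh ħ hħ A Ψ)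
    (ψ : L2 (Conf N)) : B' (U ψ) = U (B ψ) := by
  refine denseRange_schwartz_toLp.induction_on (p := fun ψ => B' (U ψ) = U (B ψ)) ψ
    (isClosed_eq (B'.continuous.comp U.continuous) (U.continuous.comp B.continuous))
    fun ψ => Lp.ext ?_
  have hleft : B' (U (ψ.toLp 2)) =ᵐ[volume] weylPh ħ hħ A (wptSchwartz ħ hħ φ ψ) := by
    rw [apply_toLp_eq_toLp_wptSchwartz hħ hU]
    exact hB' _
  have hright : U (B (ψ.toLp 2)) =ᵐ[volume] wptDist ħ φ (weylSch ħ hħ A ψ) := by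
    rw [wptDist_eq_wpt (hB ψ)]
    exact hU _
  rw [weylPh_wptSchwartz] at hleft
  exact hleft.trans hright.symm

end Intertwining

end PhaseSpaceWeyl

theorem mainTheorem1 (N : ℕ) (ħ : ℝ) (hħ : 0 < ħ) (φ : 𝓢(Conf N, ℂ))
    (hφ : ∫ x, ‖φ x‖ ^ 2 = 1) :
    ∃ U : L2 (Conf N) →ₗᵢ[ℂ] L2 (Phase N),
      -- `U` is the Wigner wave-packet transform with window `φ`
      (∀ ψ, U ψ =ᵐ[volume] wpt ħ φ ψ) ∧
      -- (i) intertwining of the representations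
      (∀ g ψ, tPh ħ g (U ψ) = U (tSch ħ g ψ)) ∧
      -- the range of `U` is closed, and the phase-space representation restricts to a
      -- representation on it which is equivalent to the Schrödinger one and irreducible
      IsClosed (Set.range U) ∧
      (∃ ρ : Heisenberg N →*
          (LinearMap.range U.toLinearMap ≃ₗᵢ[ℂ] LinearMap.range U.toLinearMap),
        (∀ g Ψ, (ρ g Ψ : L2 (Phase N)) = tPh ħ g Ψ) ∧
        UnitarilyEquivalent (tSch ħ) ρ ∧
        IsIrreducibleUnitaryRep ρ) ∧
      -- (ii) Weyl operators of tempered symbols, on Schwartz functions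
      (∀ (A : 𝓢'(Phase N, ℂ)) (ψ : 𝓢(Conf N, ℂ)),
        weylPh ħ hħ A (wptSchwartz ħ hħ φ ψ) = wptDist ħ φ (weylSch ħ hħ A ψ)) ∧
      -- (ii) their extensions by continuity to bounded operators on `L²`
      (∀ (A : 𝓢'(Phase N, ℂ)) (B : L2 (Conf N) →L[ℂ] L2 (Conf N))
        (B' : L2 (Phase N) →L[ℂ] L2 (Phase N)),
        (∀ ψ χ : 𝓢(Conf N, ℂ), weylSch ħ hħ A ψ χ = ∫ x, B (ψ.toLp 2) x * χ x) →
        (∀ Ψ : 𝓢(Phase N, ℂ), B' (Ψ.toLp 2) =ᵐ[volume] weylPh ħ hħ A Ψ) →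
        ∀ ψ, B' (U ψ) = U (B ψ)) ∧
      -- (ii) Weyl operators given by Bochner integrals on `L²`
      (∀ A : Phase N → ℂ, Integrable A → Integrable (symplecticFourier ħ A) → ∀ ψ,
        weylBochner ħ (tPh ħ) A (U ψ) = U (weylBochner ħ (tSch ħ) A ψ)) := by
  obtain ⟨U, hU⟩ := exists_wptIsometry hħ hφ
  have hint : ∀ g ψ, tPh ħ g (U ψ) = U (tSch ħ g ψ) := tPh_intertwining hU
  have : Nontrivial (L2 (Conf N)) :=
    nontrivial_Lp_two_of_integral_norm_sq_ne_zero (φ.memLp 2) (hφ ▸ one_ne_zero)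
  have hequiv := unitarilyEquivalent_conjRep U.equivRange (tSch ħ)
  exact ⟨U, hU, hint, U.isometry.isClosedEmbedding.isClosed_range,
    ⟨conjRep U.equivRange (tSch ħ), coe_conjRep_equivRange hint, hequiv,
      (isIrreducibleUnitaryRep_tSch hħ.ne').of_unitarilyEquivalent hequiv⟩,
    weylPh_wptSchwartz hħ φ, fun _ _ _ => weyl_extension_intertwining hħ hU,
    fun A _ _ => weylBochner_apply_of_intertwining ħ hint A⟩
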